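/- **Definitions.** Let $M$ be a monoid. Say that $x$ is a left divisor of $y$ (and $y$ a right multiple of $x$) if $xz=y$ for some $z$, and a right divisor of $y$ if $zx=y$ for some $z$; right lcm's and left gcd's (resp. left lcm's and right gcd's) are taken with respect to left (resp. right) divisibility. An atom is an element $x\neq 1$ such that $x=yz$ implies $y=1$ or $z=1$; $M$ is atomic if it is generated by its atoms and, for each $x\in M$, the lengths of the decompositions of $x$ as a product of atoms are bounded. $M$ is Gaussian if it is atomic, cancellative, and any two elements have a right lcm, a left lcm, a right gcd and a left gcd. $M$ is a *Garside monoid* if it is Gaussian and contains an element $\Delta$ whose left divisors coincide with its right divisors, are finite in number, and generate $M$. When they are uniquely determined, $x\vee y$ denotes the right lcm and $x\backslash y$ the element with $x\vee y=x(x\backslash y)$. Let $\Sigma$ be a non-empty set, $\Sigma^*$ the set of words on $\Sigma$, $\varepsilon$ the empty word. A *reversing function* on $\Sigma$ is a partial map $f$ from $\Sigma\times\Sigma$ to $\Sigma^*$ with symmetric domain and with $f(a,a)=\varepsilon$ for all $a$; $R_f$ is the family of relations $af(a,b)=bf(b,a)$ for $(a,b)\in\mathrm{Dom}(f)$, and $\langle\Sigma;R_f\rangle^+$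 is the monoid it presents. If $\Sigma$ is a generating family of $M$ (that is, a map $\Sigma\to M$ whose image generates $M$), a partial map $f$ from $\Sigma\times\Sigma$ to $\Sigma^*$ is an *lcm selector* on $\Sigma$ if $f(a,b)$ is defined exactly when $a,b$ have a right lcm in $M$, and is then an expression of $a\backslash b$. A word on $\Sigma\cup\Sigma^{-1}$ is $f$-reversed by repeatedly replacing a factor $a^{-1}b$ ($a,b\in\Sigma$, $(a,b)\in \mathrm{Dom}(f)$) with $f(a,b)f(b,a)^{-1}$. For $u,v\in\Sigma^*$, $u\backslash_f v$ is the (unique) word $w\in\Sigma^*$ such that $u^{-1}v$ is reversed in finitely many steps to $ww'^{-1}$ for some $w'\in\Sigma^*$, if it exists (otherwise it is undefined, written $\bot$, and any expression containing $\bot$ is $\bot$), and $u\vee_f v=u(u\backslash_f v)$. Write $u\equiv_f^{++}v$ if $u\backslash_f v=v\backslash_f u=\varepsilon$; moreover $\bot\equiv_f^{++}\bot$ holds, while $\bot$ is equivalent to no word. The function $f$ has the *cube property* on $X\subseteq\Sigma^*$ if $(u\backslash_f v)\backslash_f(u\backslash_f w)\equiv_f^{++}(v\backslash_f u)\backslash_f(v\backslash_f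 w)$ for all $u,v,w\in X$. For a reversing function $f$ on $\Sigma$, let $(**)$ be the conjunction of the following conditions: (i) the closure $\widetilde\Sigma$ of $\Sigma$ under $\backslash_f$ exists (that is, $u\backslash_f v$ is defined for all $u,v\in\widetilde\Sigma$) and is finite; (ii) $f$ has the cube property on $\widetilde\Sigma$; (iii) denoting by $\widetilde\Sigma^{\vee}$ the closure of $\widetilde\Sigma$ under $\vee_f$, there is a word $\Omega\in\widetilde\Sigma^{\vee}$ such that, for every $u\in\widetilde\Sigma^{\vee}$, one has $\Omega\backslash_f u=\varepsilon$ and there is $v\in\widetilde\Sigma^{\vee}$ with $v\backslash_f\Omega\equiv_f^{++}u$. **Theorem.** Let $\Sigma$ be a non-empty set. (1) If $M$ is a Garside monoid, $\Sigma$ is a finite generating family of $M$ not containing $1$, and $f$ is an lcm selector on $\Sigma$, then $f$ is a reversing function on $\Sigma$, it satisfies $(**)$, and $M$ admits the presentation $\langle\Sigma;R_f\rangle^+$, i.e. the given map $\Sigma\to M$ induces an isomorphism $\langle\Sigma;R_f\rangle^+\cong M$. (2) Conversely, if $f$ is a reversing function on $\Sigma$ satisfying $(**)$, then $\langle\Sigma;R_f\rangle^+$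 is a Garside monoid and $f$ is an lcm selector on $\Sigma$ in it. (3) If $f$ is a reversing function on $\Sigma$ satisfying (i) and (ii), then $\widetilde\Sigma^{\vee}$ exists (that is, $\vee_f$ is everywhere defined on it) and is finite. -/

import Mathlib

/-!
Divisibility, Gaussian and Garside monoids, word reversing associated with a complemented
presentation, lcm selectors, and the finite conditions on a reversing function.
-/

universe u v

namespace GarsideReversing

section Monoids

variable {M : Type v} [Monoid M]

/-- `x` is a left divisor of `y` (equivalently, `y` is a right multiple of `x`). -/
def LeftDvd (x y : M) : Prop := ∃ z, x * z = y

/-- `x` is a right divisor of `y` (equivalently, `y` is a left multiple of `x`). -/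
def RightDvd (x y : M) : Prop := ∃ z, z * x = y

/-- `z` is a right lcm of `x` and `y`. -/
def IsRightLcm (x y z : M) : Prop :=
  LeftDvd x z ∧ LeftDvd y z ∧ ∀ t, LeftDvd x t → LeftDvd y t → LeftDvd z t

/-- `z` is a left lcm of `x` and `y`. -/
def IsLeftLcm (x y z : M) : Prop :=
  RightDvd x z ∧ RightDvd y z ∧ ∀ t, RightDvd x t → RightDvd y t → RightDvd z t

/-- `z` is a left gcd of `x` and `y`. -/
def IsLeftGcd (x y z : M) : Prop :=
  LeftDvd z x ∧ LeftDvd z y ∧ ∀ t, LeftDvd t x → LeftDvd t y → LeftDvd t z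

/-- `z` is a right gcd of `x` and `y`. -/
def IsRightGcd (x y z : M) : Prop :=
  RightDvd z x ∧ RightDvd z y ∧ ∀ t, RightDvd t x → RightDvd t y → RightDvd t z

/-- `z` is the right complement `x \ y`: the element with `x * z` the right lcm of `x` and `y`. -/
def IsRightComplement (x y z : M) : Prop := IsRightLcm x y (x * z)

/-- Atoms: elements `x ≠ 1` such that `x = y * z` implies `y = 1` or `z = 1`. -/
def IsAtomElt (x : M) : Prop := x ≠ 1 ∧ ∀ y z, x = y * z → y = 1 ∨ z = 1

variable (M) in
/-- `M` is generated by its atoms, and for every `x` the lengths of the decompositions of `x` as a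
product of atoms are bounded. -/
structure IsAtomicMonoid : Prop where
  generated : Submonoid.closure {x : M | IsAtomElt x} = ⊤
  norm_finite : ∀ x : M, ∃ N : ℕ, ∀ l : List M,
    (∀ a ∈ l, IsAtomElt a) → l.prod = x → l.length ≤ N

variable (M) in
/-- Gaussian monoids. -/
structure IsGaussian : Prop where
  atomic : IsAtomicMonoid M
  cancel : IsCancelMul M
  right_lcm : ∀ x y : M, ∃ z, IsRightLcm x y z
  left_lcm : ∀ x y : M, ∃ z, IsLeftLcm x y z
  right_gcd : ∀ x y : M, ∃ z, IsRightGcd x y z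
  left_gcd : ∀ x y : M, ∃ z, IsLeftGcd x y z

/-- Garside elements: the left and the right divisors coincide, are finitely many, and
generate. -/
structure IsGarsideElement (Δ : M) : Prop where
  divisors_eq : {x : M | LeftDvd x Δ} = {x : M | RightDvd x Δ}
  finite : {x : M | LeftDvd x Δ}.Finite
  generate : Submonoid.closure {x : M | LeftDvd x Δ} = ⊤

variable (M) in
/-- Garside monoids: Gaussian monoids that contain a Garside element. -/
structure IsGarside : Prop where
  gaussian : IsGaussian M
  exists_garside : ∃ Δ : M, IsGarsideElement Δ

end Monoids

section Reversing

variable {A : Type u}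

/-- A partial function `f` from `A × A` to words is an lcm selector on the generating family
`ι : A → M`: `f a b` is defined exactly when `ι a` and `ι b` have a right lcm, and it is then an
expression of the right complement of `ι a` and `ι b`. -/
structure IsLcmSelector {M : Type v} [Monoid M] (ι : A → M)
    (f : A → A → Option (FreeMonoid A)) : Prop where
  generates : Submonoid.closure (Set.range ι) = ⊤
  defined_iff : ∀ a b, (∃ w, f a b = some w) ↔ ∃ z, IsRightLcm (ι a) (ι b) z
  complement : ∀ a b w, f a b = some w → IsRightComplement (ι a) (ι b) (FreeMonoid.lift ι w)

/-- Reversing functions: partial functions `f` from `A × A` to words with symmetric domain and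
`f a a` equal to the empty word. -/
structure IsReversingFunction (f : A → A → Option (FreeMonoid A)) : Prop where
  self : ∀ a, f a a = some 1
  symm : ∀ a b, (∃ w, f a b = some w) → ∃ w, f b a = some w

/-- The relations `a f(a,b) = b f(b,a)`. -/
def rels (f : A → A → Option (FreeMonoid A)) (u v : FreeMonoid A) : Prop :=
  ∃ a b w w', f a b = some w ∧ f b a = some w' ∧
    u = FreeMonoid.of a * w ∧ v = FreeMonoid.of b * w'

/-- A word on `A` as a word on `A ∪ A⁻¹`; `Sum.inl a` is the letter `a`, `Sum.inr a` the letter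
`a⁻¹`. -/
def pos (w : FreeMonoid A) : FreeMonoid (A ⊕ A) := FreeMonoid.map Sum.inl w

/-- The formal inverse `w⁻¹` of a word `w` on `A`, as a word on `A ∪ A⁻¹`. -/
def neg (w : FreeMonoid A) : FreeMonoid (A ⊕ A) := FreeMonoid.map Sum.inr w.reverse

/-- One step of reversing: a factor `a⁻¹ b` is replaced with `f(a,b) f(b,a)⁻¹`. -/
inductive RevStep (f : A → A → Option (FreeMonoid A)) :
    FreeMonoid (A ⊕ A) → FreeMonoid (A ⊕ A) → Prop
  | intro (x y : FreeMonoid (A ⊕ A)) (a b : A) (w w' : FreeMonoid A)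
      (h : f a b = some w) (h' : f b a = some w') :
      RevStep f (x * FreeMonoid.of (Sum.inr a) * FreeMonoid.of (Sum.inl b) * y)
        (x * pos w * neg w' * y)

/-- Reversing: finitely many reversing steps. -/
def Reverses (f : A → A → Option (FreeMonoid A)) :
    FreeMonoid (A ⊕ A) → FreeMonoid (A ⊕ A) → Prop :=
  Relation.ReflTransGen (RevStep f)

open Classical in
/-- The partial operation `u \_f v` on words: the (unique) word `w` such that `u⁻¹ v` reverses to
`w w'⁻¹` for some word `w'`, and `none` if there is no such word. -/
noncomputable def under (f : A → A → Option (FreeMonoid A)) (u v : FreeMonoid A) :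
    Option (FreeMonoid A) :=
  if h : ∃ w, ∃ w', Reverses f (neg u * pos v) (pos w * neg w') then some h.choose else none

/-- The operation `\_f` on words extended by an undefined value `none`. -/
noncomputable def underBot (f : A → A → Option (FreeMonoid A)) (u v : Option (FreeMonoid A)) :
    Option (FreeMonoid A) :=
  u.bind fun u' => v.bind fun v' => under f u' v'

/-- The partial operation `u ∨_f v = u (u \_f v)` on words. -/
noncomputable def join (f : A → A → Option (FreeMonoid A)) (u v : FreeMonoid A) :
    Option (FreeMonoid A) :=
  (under f u v).map fun w => u * w

/-- The relation `u ≡⁺⁺ v`: both `u \_f v` and `v \_f u` are the empty word; the undefined value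
is related to itself only. -/
def EquivPP (f : A → A → Option (FreeMonoid A)) :
    Option (FreeMonoid A) → Option (FreeMonoid A) → Prop
  | some u, some v => under f u v = some 1 ∧ under f v u = some 1
  | none, none => True
  | _, _ => False

/-- The cube property of `f` on a set `X` of words. -/
def CubeOn (f : A → A → Option (FreeMonoid A)) (X : Set (FreeMonoid A)) : Prop :=
  ∀ u ∈ X, ∀ v ∈ X, ∀ w ∈ X,
    EquivPP f (underBot f (under f u v) (under f u w)) (underBot f (under f v u) (under f v w))

/-- The smallest set of words that contains `X` and is stable under a partial operation `op`
wherever `op` is defined. -/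
inductive OpClosure (op : FreeMonoid A → FreeMonoid A → Option (FreeMonoid A))
    (X : Set (FreeMonoid A)) : FreeMonoid A → Prop
  | base (u : FreeMonoid A) (hu : u ∈ X) : OpClosure op X u
  | step (u v w : FreeMonoid A) (hu : OpClosure op X u) (hv : OpClosure op X v)
      (hw : op u v = some w) : OpClosure op X w

/-- The operation `op` is defined on all pairs of elements of `X`. -/
def DefinedOn (op : FreeMonoid A → FreeMonoid A → Option (FreeMonoid A))
    (X : Set (FreeMonoid A)) : Prop :=
  ∀ u ∈ X, ∀ v ∈ X, ∃ w, op u v = some w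

/-- The closure of the alphabet (as a set of one-letter words) under `\_f`. -/
def underClosure (f : A → A → Option (FreeMonoid A)) : Set (FreeMonoid A) :=
  {w | OpClosure (under f) (Set.range FreeMonoid.of) w}

/-- The closure under `∨_f` of the closure of the alphabet under `\_f`. -/
def joinClosure (f : A → A → Option (FreeMonoid A)) : Set (FreeMonoid A) :=
  {w | OpClosure (join f) (underClosure f) w}

/-- The closure of the alphabet under `\_f` exists, that is, `\_f` is defined
everywhere on it, and it is finite. -/
def FiniteClosure (f : A → A → Option (FreeMonoid A)) : Prop :=
  DefinedOn (under f) (underClosure f) ∧ (underClosure f).Finite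

/-- There is a word `Ω` in the `∨_f`-closure such that, for every `u` in that closure, `Ω \_f u` is
empty and `u` is `≡⁺⁺`-equivalent to `v \_f Ω` for some `v` in that closure. -/
def OmegaCondition (f : A → A → Option (FreeMonoid A)) : Prop :=
  ∃ Ω ∈ joinClosure f, ∀ u ∈ joinClosure f,
    under f Ω u = some 1 ∧ ∃ v ∈ joinClosure f, EquivPP f (under f v Ω) (some u)

/-- The conjunction `(**)` of the three conditions. -/
structure StarStar (f : A → A → Option (FreeMonoid A)) : Prop where
  finite_closure : FiniteClosure f
  cube : CubeOn f (underClosure f)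
  omega : OmegaCondition f

end Reversing

end GarsideReversing

open GarsideReversing

/-! Reversing `u⁻¹ v` fills a rectangle with squares `a f(a,b) = b f(b,a)`, so `u \_f v` ought to be
a right complement. `IsReversingModel` records when it is: words map onto a left cancellative
monoid, only the empty word goes to `1`, and reversing always ends and computes right lcm's. In a
model `≡⁺⁺` is equality of values, and both sides of the cube have the value `(u ∨ v) \ w`.

A Garside monoid is a model of its lcm selector (`IsLcmSelector.isReversingModel`): atomicity
supplies a norm, and reversing ends by induction on the norm of a common multiple. The letters lie
in a power of the set of divisors of `Δ`; that power is finite and stable under complement, so the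
closure is finite. For `Ω` one takes a common multiple of the finite join closure; right
cancellation makes `s ↦ s \ Ω` injective on values, hence onto.

Conversely, (i) makes reversing total and the cube property spreads from the closure to all words
(`cubeAt_of_closure`). Then `≡⁺⁺` is the presented congruence, left cancellation is the identity
`(wu) \ (wv) = u \ v`, and the cube gives the lcm's (`isReversingModel_mk`). By (iii), `s ↦ s \ Ω`
permutes a finite generating set, so a power of `Ω` is central (`exists_central_pow`). This yields
right cancellation and common left multiples; counting right divisors gives a norm, hence atomicity,
gcd's and left lcm's.

For finiteness of the join closure, a value in it is determined by the values of the first closure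
that divide it, and the number of nonempty factors needed to build a word of it is bounded by the
number of values. -/

namespace GarsideReversing

/-! ### Reversing as a confluent rewriting system on signed words -/

section Words

variable {A : Type u} {f : A → A → Option (FreeMonoid A)}

theorem pos_one : pos (1 : FreeMonoid A) = 1 := rfl

theorem neg_one : neg (1 : FreeMonoid A) = 1 := rfl

theorem pos_mul (u v : FreeMonoid A) : pos (u * v) = pos u * pos v := map_mul _ _ _

theorem neg_mul (u v : FreeMonoid A) : neg (u * v) = neg v * neg u := by
  simp [neg, FreeMonoid.reverse_mul]

theorem toList_pos (w : FreeMonoid A) : (pos w).toList = w.toList.map Sum.inl := rfl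

theorem toList_neg (w : FreeMonoid A) : (neg w).toList = w.toList.reverse.map Sum.inr := rfl

theorem RevStep.mul_mul {s t : FreeMonoid (A ⊕ A)} (h : RevStep f s t)
    (p q : FreeMonoid (A ⊕ A)) : RevStep f (p * s * q) (p * t * q) := by
  obtain ⟨x, y, a, b, w, w', h, h'⟩ := h
  have := RevStep.intro (p * x) (y * q) a b w w' h h'
  simpa only [mul_assoc] using this

theorem Reverses.mul_mul {s t : FreeMonoid (A ⊕ A)} (h : Reverses f s t)
    (p q : FreeMonoid (A ⊕ A)) : Reverses f (p * s * q) (p * t * q) :=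
  Relation.ReflTransGen.lift (fun s => p * s * q) (fun _ _ h => RevStep.mul_mul h p q) _ _ h

/-- The formal inverse of a signed word. -/
def formalInv (s : FreeMonoid (A ⊕ A)) : FreeMonoid (A ⊕ A) := FreeMonoid.map Sum.swap s.reverse

theorem formalInv_mul (s t : FreeMonoid (A ⊕ A)) :
    formalInv (s * t) = formalInv t * formalInv s := by
  simp [formalInv, FreeMonoid.reverse_mul]

theorem formalInv_pos (w : FreeMonoid A) : formalInv (pos w) = neg w := by
  apply FreeMonoid.toList.injective
  change List.map Sum.swap (List.reverse (List.map Sum.inl w.toList)) = _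
  rw [toList_neg, ← List.map_reverse, List.map_map]
  rfl

theorem formalInv_neg (w : FreeMonoid A) : formalInv (neg w) = pos w := by
  apply FreeMonoid.toList.injective
  change List.map Sum.swap (List.reverse (List.map Sum.inr w.toList.reverse)) = _
  rw [toList_pos, ← List.map_reverse, List.map_map, List.reverse_reverse]
  rfl

theorem RevStep.formalInv {s t : FreeMonoid (A ⊕ A)} (h : RevStep f s t) :
    RevStep f (formalInv s) (formalInv t) := by
  obtain ⟨x, y, a, b, w, w', h, h'⟩ := h
  have := RevStep.intro (GarsideReversing.formalInv y) (GarsideReversing.formalInv x) b a w' w h' h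
  simp only [formalInv_mul, formalInv_pos, formalInv_neg]
  simp only [mul_assoc] at this ⊢
  exact this

theorem Reverses.formalInv {s t : FreeMonoid (A ⊕ A)} (h : Reverses f s t) :
    Reverses f (formalInv s) (formalInv t) :=
  Relation.ReflTransGen.lift _ (fun _ _ h => RevStep.formalInv h) _ _ h

theorem not_revStep_pos_mul_neg (w w' : FreeMonoid A) (t : FreeMonoid (A ⊕ A)) :
    ¬ RevStep f (pos w * neg w') t := by
  intro h
  -- No negative letter stands anywhere before a positive one; a factor `a⁻¹ b` violates this.
  have hp : ((pos w * neg w').toList).Pairwise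
      (fun x y => x.isLeft = true ∨ y.isRight = true) := by
    rw [FreeMonoid.toList_mul, toList_pos, toList_neg, List.pairwise_append]
    refine ⟨?_, ?_, ?_⟩
    · rw [List.pairwise_map]; exact List.pairwise_of_forall (by simp)
    · rw [List.pairwise_map]; exact List.pairwise_of_forall (by simp)
    · intro a ha b _
      obtain ⟨c, _, rfl⟩ := List.mem_map.1 ha
      simp
  generalize hs : pos w * neg w' = s at h hp
  obtain ⟨x, y, a, b, v, v', h, h'⟩ := h
  simp only [mul_assoc, FreeMonoid.toList_mul, FreeMonoid.toList_of, List.pairwise_append] at hp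
  have := hp.2.1.2.2 (Sum.inr a) (by simp) (Sum.inl b) (by simp)
  simp at this

theorem pos_mul_neg_inj {w w' z z' : FreeMonoid A} (h : pos w * neg w' = pos z * neg z') :
    w = z ∧ w' = z' := by
  have h := congrArg FreeMonoid.toList h
  simp only [FreeMonoid.toList_mul, toList_pos, toList_neg] at h
  have h1 := congrArg (List.filterMap Sum.getLeft?) h
  have h2 := congrArg (List.filterMap Sum.getRight?) h
  simp [List.filterMap_append, List.filterMap_map, Function.comp_def] at h1 h2
  exact ⟨h1, h2⟩

/-- Two factors `a⁻¹ b` cannot share exactly one letter, which would be both positive and negative.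
So they coincide, and `f` fixes the result, or they are disjoint and the two steps commute. -/
theorem revStep_diamond {s t t' : FreeMonoid (A ⊕ A)} (h : RevStep f s t) (h' : RevStep f s t') :
    t = t' ∨ ∃ r, RevStep f t r ∧ RevStep f t' r := by
  have key : ∀ (x y x' y' : FreeMonoid (A ⊕ A)) (a b a' b' : A) (w w' z z' : FreeMonoid A),
      f a b = some w → f b a = some w' → f a' b' = some z → f b' a' = some z' →
      x * FreeMonoid.of (Sum.inr a) * FreeMonoid.of (Sum.inl b) * y =
        x' * FreeMonoid.of (Sum.inr a') * FreeMonoid.of (Sum.inl b') * y' →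
      (∃ m, x' = x * m) →
      x * pos w * neg w' * y = x' * pos z * neg z' * y' ∨
        ∃ r, RevStep f (x * pos w * neg w' * y) r ∧ RevStep f (x' * pos z * neg z' * y') r := by
    rintro x y x' y' a b a' b' w w' z z' h1 h2 h3 h4 he ⟨m, rfl⟩
    simp only [mul_assoc, mul_right_inj] at he
    have he' := congrArg FreeMonoid.toList he
    simp only [FreeMonoid.toList_mul, FreeMonoid.toList_of] at he'
    rcases hm : m.toList with _ | ⟨c, _ | ⟨d, m'⟩⟩
    · left
      have : m = 1 := FreeMonoid.toList.injective hm
      subst this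
      simp only [hm, List.nil_append, List.cons_append, List.cons.injEq, Sum.inr.injEq,
        Sum.inl.injEq] at he'
      obtain ⟨rfl, rfl, hy⟩ := he'
      have : y = y' := FreeMonoid.toList.injective hy
      rw [h1] at h3
      rw [h2] at h4
      cases h3
      cases h4
      rw [this, mul_one]
    · simp [hm] at he'
    · right
      simp only [hm, List.nil_append, List.cons_append, List.cons.injEq] at he'
      obtain ⟨rfl, rfl, hy⟩ := he'
      have hm2 : m = FreeMonoid.of (Sum.inr a) * FreeMonoid.of (Sum.inl b) *
          FreeMonoid.ofList m' := FreeMonoid.toList.injective hm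
      have hy2 : y = FreeMonoid.ofList m' * FreeMonoid.of (Sum.inr a') *
          FreeMonoid.of (Sum.inl b') * y' :=
        FreeMonoid.toList.injective (by simp [hy])
      refine ⟨x * pos w * neg w' * FreeMonoid.ofList m' * pos z * neg z' * y', ?_, ?_⟩
      · have := RevStep.intro (x * pos w * neg w' * FreeMonoid.ofList m') y' a' b' z z' h3 h4
        rw [hy2]
        simpa only [mul_assoc] using this
      · have := RevStep.intro x (FreeMonoid.ofList m' * pos z * neg z' * y') a b w w' h1 h2
        rw [hm2]
        simpa only [mul_assoc] using this
  generalize hs' : s = s' at h'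
  obtain ⟨x, y, a, b, w, w', h1, h2⟩ := h
  obtain ⟨x', y', a', b', z, z', h3, h4⟩ := h'
  have hl := congrArg FreeMonoid.toList hs'
  simp only [mul_assoc, FreeMonoid.toList_mul] at hl
  rcases List.append_eq_append_iff.1 hl with ⟨m, hm, -⟩ | ⟨m, hm, -⟩
  · exact key _ _ _ _ _ _ _ _ _ _ _ _ h1 h2 h3 h4 hs'
      ⟨FreeMonoid.ofList m, FreeMonoid.toList.injective hm⟩
  · rcases key _ _ _ _ _ _ _ _ _ _ _ _ h3 h4 h1 h2 hs'.symm
      ⟨FreeMonoid.ofList m, FreeMonoid.toList.injective hm⟩ with h | ⟨r, hr, hr'⟩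
    · exact Or.inl h.symm
    · exact Or.inr ⟨r, hr', hr⟩

/-- The word `u⁻¹ v` reverses to `w w'⁻¹`. -/
def RevTo (f : A → A → Option (FreeMonoid A)) (u v w w' : FreeMonoid A) : Prop :=
  Reverses f (neg u * pos v) (pos w * neg w')

theorem RevTo.unique {u v w w' z z' : FreeMonoid A} (h : RevTo f u v w w')
    (h' : RevTo f u v z z') : w = z ∧ w' = z' := by
  obtain ⟨t, ht, ht'⟩ := Relation.church_rosser (r := RevStep f)
    (fun a b c hb hc => by
      rcases revStep_diamond hb hc with rfl | ⟨r, hr, hr'⟩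
      · exact ⟨b, .refl, .refl⟩
      · exact ⟨r, .single hr, .single hr'⟩) h h'
  rcases ht.cases_head with rfl | ⟨_, h1, _⟩
  · rcases ht'.cases_head with h2 | ⟨_, h1, _⟩
    · exact pos_mul_neg_inj h2.symm
    · exact (not_revStep_pos_mul_neg _ _ _ h1).elim
  · exact (not_revStep_pos_mul_neg _ _ _ h1).elim

theorem RevTo.symm {u v w w' : FreeMonoid A} (h : RevTo f u v w w') : RevTo f v u w' w := by
  have := Reverses.formalInv h
  simp only [formalInv_mul, formalInv_pos, formalInv_neg] at this
  exact this

theorem RevTo.one_left (v : FreeMonoid A) : RevTo f 1 v v 1 := by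
  rw [RevTo, neg_one, one_mul, mul_one]
  exact .refl

theorem RevTo.one_right (u : FreeMonoid A) : RevTo f u 1 1 u := (RevTo.one_left u).symm

/-- Two reversing diagrams are stacked along the common edge `w`. -/
theorem RevTo.mul_left {u₁ u₂ v w z w' z' : FreeMonoid A} (h₁ : RevTo f u₁ v w w')
    (h₂ : RevTo f u₂ w z z') : RevTo f (u₁ * u₂) v z (w' * z') := by
  have h1 := Reverses.mul_mul h₁ (neg u₂) 1
  have h2 := Reverses.mul_mul h₂ 1 (neg w')
  rw [RevTo, neg_mul, neg_mul]
  simp only [mul_assoc, one_mul, mul_one] at h1 h2 ⊢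
  exact h1.trans h2

theorem RevTo.mul_right {u v₁ v₂ w z w' z' : FreeMonoid A} (h₁ : RevTo f u v₁ w w')
    (h₂ : RevTo f w' v₂ z z') : RevTo f u (v₁ * v₂) (w * z) z' :=
  (RevTo.mul_left h₁.symm h₂.symm).symm

theorem RevTo.of_of {a b : A} {w w' : FreeMonoid A} (h : f a b = some w) (h' : f b a = some w') :
    RevTo f (FreeMonoid.of a) (FreeMonoid.of b) w w' := by
  have := RevStep.intro 1 1 a b w w' h h'
  simp only [one_mul, mul_one] at this
  exact .single this

/-- The word `a⁻¹ b` is not yet of the form `w w'⁻¹`, and the only step that applies to it uses `f a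
b` and `f b a`. -/
theorem RevTo.eq_some_of_of {a b : A} {w w' : FreeMonoid A}
    (h : RevTo f (FreeMonoid.of a) (FreeMonoid.of b) w w') :
    f a b = some w ∧ f b a = some w' := by
  have key : ∃ z z', f a b = some z ∧ f b a = some z' := by
    rcases h.cases_head with h1 | ⟨_, h1, -⟩
    · exfalso
      have h2 := congrArg FreeMonoid.toList h1
      change [Sum.inr a, Sum.inl b] = _ at h2
      simp only [FreeMonoid.toList_mul, toList_pos, toList_neg] at h2
      rcases hw : w.toList with _ | ⟨c, l⟩ <;> rw [hw] at h2
      · have : (Sum.inl b : A ⊕ A) ∈ [Sum.inr a, Sum.inl b] := by simp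
        rw [h2] at this
        simp at this
      · simp at h2
    · generalize hs : neg (FreeMonoid.of a) * pos (FreeMonoid.of b) = s at h1
      obtain ⟨x, y, a', b', z, z', h1, h2⟩ := h1
      have h3 := congrArg FreeMonoid.toList hs
      change [Sum.inr a, Sum.inl b] = _ at h3
      have hl := congrArg List.length h3
      simp only [FreeMonoid.toList_mul, FreeMonoid.toList_of, List.length_append,
        List.length_cons, List.length_nil] at hl
      have hx : x.toList = [] := List.length_eq_zero_iff.1 (by omega)
      simp only [FreeMonoid.toList_mul, FreeMonoid.toList_of, hx, List.nil_append,
        List.cons_append, List.cons.injEq, Sum.inr.injEq, Sum.inl.injEq] at h3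
      obtain ⟨rfl, rfl, -⟩ := h3
      exact ⟨z, z', h1, h2⟩
  obtain ⟨z, z', h1, h2⟩ := key
  obtain ⟨rfl, rfl⟩ := h.unique (RevTo.of_of h1 h2)
  exact ⟨h1, h2⟩

theorem RevTo.self (hf : IsReversingFunction f) (u : FreeMonoid A) : RevTo f u u 1 1 := by
  induction u using FreeMonoid.inductionOn' with
  | one => exact RevTo.one_left 1
  | of_mul a u ih =>
    have h1 := RevTo.of_of (hf.self a) (hf.self a)
    have h2 := RevTo.mul_left h1 (RevTo.one_right u)
    rw [one_mul] at h2
    exact RevTo.mul_right h2 ih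

theorem under_eq_some {u v w : FreeMonoid A} : under f u v = some w ↔ ∃ w', RevTo f u v w w' := by
  unfold under
  constructor
  · intro h
    split_ifs at h with hh
    have := hh.choose_spec
    rw [Option.some.inj h] at this
    exact this
  · rintro ⟨w', h⟩
    have hh : ∃ w, ∃ w', Reverses f (neg u * pos v) (pos w * neg w') := ⟨w, w', h⟩
    rw [dif_pos hh]
    obtain ⟨z', hz⟩ := hh.choose_spec
    exact congrArg some (RevTo.unique hz h).1

end Words

/-! ### Soundness of reversing in any monoid satisfying the relations -/

section Soundness

variable {A : Type u} {f : A → A → Option (FreeMonoid A)} {M : Type v} [Monoid M]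

/-- A signed word labels a path from `x` to `y` in the Cayley graph of `M`. -/
def IsPath (π : FreeMonoid A →* M) : List (A ⊕ A) → M → M → Prop
  | [], x, y => x = y
  | Sum.inl a :: s, x, y => IsPath π s (x * π (FreeMonoid.of a)) y
  | Sum.inr a :: s, x, y => ∃ z, x = z * π (FreeMonoid.of a) ∧ IsPath π s z y

theorem isPath_append (π : FreeMonoid A →* M) (s t : List (A ⊕ A)) (x y : M) :
    IsPath π (s ++ t) x y ↔ ∃ z, IsPath π s x z ∧ IsPath π t z y := by
  induction s generalizing x with
  | nil => simp [IsPath]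
  | cons c s ih =>
    rcases c with a | a
    · simp [IsPath, ih]
    · simp only [List.cons_append, IsPath, ih]
      constructor
      · rintro ⟨z, h1, r, h2, h3⟩
        exact ⟨r, ⟨z, h1, h2⟩, h3⟩
      · rintro ⟨r, ⟨z, h1, h2⟩, h3⟩
        exact ⟨z, h1, r, h2, h3⟩

theorem isPath_pos (π : FreeMonoid A →* M) (w : FreeMonoid A) (x y : M) :
    IsPath π (pos w).toList x y ↔ y = x * π w := by
  induction w using FreeMonoid.inductionOn' generalizing x with
  | one => simp [pos_one, IsPath, eq_comm]
  | of_mul a w ih =>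
    rw [pos_mul, FreeMonoid.toList_mul, isPath_append, map_mul, ← mul_assoc]
    constructor
    · rintro ⟨z, rfl, h⟩
      exact (ih _).1 h
    · intro h
      exact ⟨_, rfl, (ih _).2 h⟩

theorem isPath_neg (π : FreeMonoid A →* M) (w : FreeMonoid A) (x y : M) :
    IsPath π (neg w).toList x y ↔ x = y * π w := by
  induction w using FreeMonoid.inductionOn' generalizing y with
  | one => simp [neg_one, IsPath]
  | of_mul a w ih =>
    rw [neg_mul, FreeMonoid.toList_mul, isPath_append, map_mul, ← mul_assoc]
    constructor
    · rintro ⟨z, h, r, rfl, h2⟩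
      rw [ih] at h
      rw [h, show r = y from h2]
    · intro h
      exact ⟨_, (ih _).2 h, _, rfl, rfl⟩

/-- A step replaces two sides of the square `a f(a,b) = b f(b,a)` by the other two. Following paths
avoids inverses, so no cancellation is needed. -/
theorem RevStep.isPath {π : FreeMonoid A →* M} (hπ : ∀ u v, rels f u v → π u = π v)
    {s t : FreeMonoid (A ⊕ A)} (h : RevStep f s t) {x y : M} (hs : IsPath π s.toList x y) :
    IsPath π t.toList x y := by
  obtain ⟨p, q, a, b, w, w', h, h'⟩ := h
  simp only [mul_assoc, FreeMonoid.toList_mul, FreeMonoid.toList_of, isPath_append,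
    isPath_pos, isPath_neg] at hs ⊢
  obtain ⟨z₁, h1, z₂, ⟨z, rfl, rfl⟩, z₃, rfl, h3⟩ := hs
  refine ⟨_, h1, _, rfl, _, ?_, h3⟩
  rw [mul_assoc, mul_assoc, ← map_mul, ← map_mul,
    hπ _ _ ⟨a, b, w, w', h, h', rfl, rfl⟩]

theorem RevTo.map_mul_eq {π : FreeMonoid A →* M} (hπ : ∀ u v, rels f u v → π u = π v)
    {u v w w' : FreeMonoid A} (h : RevTo f u v w w') : π u * π w = π v * π w' := by
  have key : ∀ s t, Reverses f s t → ∀ x y, IsPath π s.toList x y → IsPath π t.toList x y := by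
    intro s t h x y hs
    induction h with
    | refl => exact hs
    | tail _ h ih => exact h.isPath hπ ih
  -- The path runs from `π u` back to `1`, then on to `π v`.
  have h1 := key _ _ h (π u) (π v) (by
    rw [FreeMonoid.toList_mul, isPath_append]
    exact ⟨1, (isPath_neg _ _ _ _).2 (by simp), (isPath_pos _ _ _ _).2 (by simp)⟩)
  rw [FreeMonoid.toList_mul, isPath_append] at h1
  obtain ⟨z, h1, h2⟩ := h1
  rw [isPath_pos] at h1
  rw [isPath_neg] at h2
  rw [← h1, h2]

end Soundness

/-! ### Extending the cube property from a generating set -/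

section Complement

open scoped Pointwise

/-- The laws of the complement operation of a monoid where right lcm's exist, as far as they hold
already for words. -/
structure IsComplementOp {W : Type u} [Monoid W] (c : W → W → W) : Prop where
  one_left : ∀ v, c 1 v = v
  one_right : ∀ v, c v 1 = 1
  self : ∀ v, c v v = 1
  mul_left : ∀ u v w, c (u * v) w = c v (c u w)
  mul_right : ∀ w u v, c w (u * v) = c w u * c (c u w) v

variable {W : Type u} [Monoid W] {c : W → W → W}

/-- The relation `u \ v = v \ u = 1`. -/
def ComplEquiv (c : W → W → W) (u v : W) : Prop := c u v = 1 ∧ c v u = 1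

/-- The cube property at a triple of elements. -/
def CubeAt (c : W → W → W) (u v w : W) : Prop :=
  ComplEquiv c (c (c u v) (c u w)) (c (c v u) (c v w))

theorem ComplEquiv.symm {u v : W} (h : ComplEquiv c u v) : ComplEquiv c v u := ⟨h.2, h.1⟩

theorem CubeAt.symm {u v w : W} (h : CubeAt c u v w) : CubeAt c v u w := ⟨h.2, h.1⟩

theorem exists_mem_pow_of_closure_eq_top {X : Set W} (hgen : Submonoid.closure X = ⊤) (u : W) :
    ∃ n : ℕ, u ∈ X ^ n := by
  have hu : u ∈ Submonoid.closure X := hgen ▸ Submonoid.mem_top u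
  induction hu using Submonoid.closure_induction_right with
  | one => exact ⟨0, by simp⟩
  | mul_right x _ y hy ih =>
    obtain ⟨n, hn⟩ := ih
    exact ⟨n + 1, pow_succ X n ▸ Set.mul_mem_mul hn hy⟩

namespace IsComplementOp

variable (hc : IsComplementOp c)
include hc

theorem equiv_one {u : W} (h : ComplEquiv c 1 u) : u = 1 := by
  have := h.1
  rwa [hc.one_left] at this

theorem equiv_refl (u : W) : ComplEquiv c u u := ⟨hc.self u, hc.self u⟩

/-- With `c u v = 1` read as "`v` divides `u`", this is the universal property of the lcm: it
divides any common multiple. -/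
theorem eq_one_of_cubeAt {u v w : W} (h : CubeAt c u v w) (huv : c u v = 1) (huw : c u w = 1) :
    c (c v u) (c v w) = 1 := by
  rw [CubeAt, huv, huw, hc.self] at h
  exact hc.equiv_one h

theorem equiv_trans {u v w : W} (h₁ : CubeAt c v u w) (h₂ : CubeAt c v w u)
    (huv : ComplEquiv c u v) (hvw : ComplEquiv c v w) : ComplEquiv c u w := by
  constructor
  · have := hc.eq_one_of_cubeAt h₁ huv.2 hvw.1
    rwa [huv.1, hc.one_left] at this
  · have := hc.eq_one_of_cubeAt h₂ hvw.1 huv.2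
    rwa [hvw.2, hc.one_left] at this

theorem equiv_left {u v w : W} (h : CubeAt c u v w) (huv : ComplEquiv c u v) :
    ComplEquiv c (c u w) (c v w) := by
  rwa [CubeAt, huv.1, huv.2, hc.one_left, hc.one_left] at h

theorem equiv_right {u v w : W} (h₁ : CubeAt c u w v) (h₂ : CubeAt c v w u)
    (huv : ComplEquiv c u v) : ComplEquiv c (c w u) (c w v) := by
  rw [CubeAt, huv.1, hc.one_right] at h₁
  rw [CubeAt, huv.2, hc.one_right] at h₂
  exact ⟨hc.equiv_one h₁, hc.equiv_one h₂⟩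

theorem equiv_mul {a b a' b' : W} (ha : ComplEquiv c a a') (hb : ComplEquiv c b b') :
    ComplEquiv c (a * b) (a' * b') := by
  have key : ∀ {a b a' b' : W}, ComplEquiv c a a' → ComplEquiv c b b' →
      c (a * b) (a' * b') = 1 := by
    intro a b a' b' ha hb
    rw [hc.mul_left, hc.mul_right, ha.1, ha.2, hc.one_left, one_mul, hb.1]
  exact ⟨key ha hb, key ha.symm hb.symm⟩

theorem mul_equiv_mul (u v : W) : ComplEquiv c (u * c u v) (v * c v u) := by
  have key : ∀ u v, c (u * c u v) (v * c v u) = 1 := by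
    intro u v
    rw [hc.mul_left, hc.mul_right, hc.self, mul_one, hc.self]
  exact ⟨key u v, key v u⟩

theorem mul_left_mul (w u v : W) : c (w * u) (w * v) = c u v := by
  rw [hc.mul_left, hc.mul_right, hc.self, hc.one_left, one_mul]

theorem equiv_trans_of_mem {X : Set W} (hcube : ∀ u ∈ X, ∀ v ∈ X, ∀ w ∈ X, CubeAt c u v w)
    {u v w : W} (hu : u ∈ X) (hv : v ∈ X) (hw : w ∈ X)
    (huv : ComplEquiv c u v) (hvw : ComplEquiv c v w) : ComplEquiv c u w :=
  hc.equiv_trans (hcube _ hv _ hu _ hw) (hcube _ hv _ hw _ hu) huv hvw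

section Extension

variable {X : Set W} (hX : ∀ u ∈ X, ∀ v ∈ X, c u v ∈ X) (hgen : Submonoid.closure X = ⊤)
include hX hgen

theorem mem_of_mem (u : W) {v : W} (hv : v ∈ X) : c u v ∈ X := by
  have hu : u ∈ Submonoid.closure X := hgen ▸ Submonoid.mem_top u
  induction hu using Submonoid.closure_induction_right generalizing v with
  | one => rwa [hc.one_left]
  | mul_right x _ y hy ih => rw [hc.mul_left]; exact hX _ hy _ (ih hv)

/-- The complement by `u` acts on `v` factor by factor and never lengthens it. Both finiteness
arguments on divisors and on the closure use this, with `u` arbitrary. -/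
theorem mem_pow_of_mem_pow (u : W) {n : ℕ} {v : W} (hv : v ∈ X ^ n) : c u v ∈ X ^ n := by
  induction n generalizing u v with
  | zero =>
    rw [pow_zero, Set.mem_one] at hv ⊢
    rw [hv, hc.one_right]
  | succ n ih =>
    rw [pow_succ] at hv ⊢
    obtain ⟨v₁, h₁, v₂, h₂, rfl⟩ := hv
    simp only [hc.mul_right]
    exact Set.mul_mem_mul (ih u h₁) (hc.mem_of_mem hX hgen _ h₂)

variable (hcube : ∀ u ∈ X, ∀ v ∈ X, ∀ w ∈ X, CubeAt c u v w)
include hcube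

theorem equiv_right_of_mem (u : W) {v w : W} (hv : v ∈ X) (hw : w ∈ X) (h : ComplEquiv c v w) :
    ComplEquiv c (c u v) (c u w) := by
  have hu : u ∈ Submonoid.closure X := hgen ▸ Submonoid.mem_top u
  induction hu using Submonoid.closure_induction_right generalizing v w with
  | one => rwa [hc.one_left, hc.one_left]
  | mul_right x _ y hy ih =>
    rw [hc.mul_left, hc.mul_left]
    have h1 := hc.mem_of_mem hX hgen x hv
    have h2 := hc.mem_of_mem hX hgen x hw
    exact hc.equiv_right (hcube _ h1 _ hy _ h2) (hcube _ h2 _ hy _ h1) (ih hv hw h)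

/-- Two cubes are glued along a face. Keeping `w` in `X` keeps all compared elements in `X`, where
the equivalence is already transitive. -/
theorem cubeAt_mul {u₁ u₂ v w : W} (hw : w ∈ X) (h₁ : CubeAt c u₁ v w)
    (h₂ : CubeAt c u₂ (c u₁ v) (c u₁ w)) : CubeAt c (u₁ * u₂) v w := by
  have hm := fun u {w} => hc.mem_of_mem hX hgen u (v := w)
  rw [CubeAt, hc.mul_left, hc.mul_left, hc.mul_right, hc.mul_left]
  exact hc.equiv_trans_of_mem hcube (hm _ (hm _ (hm _ hw))) (hm _ (hm _ (hm _ hw)))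
    (hm _ (hm _ (hm _ hw))) h₂
    (hc.equiv_right_of_mem hX hgen hcube _ (hm _ (hm _ hw)) (hm _ (hm _ hw)) h₁)

theorem cubeAt_of_mem_right (u v : W) {w : W} (hw : w ∈ X) : CubeAt c u v w := by
  have hm := fun u {w} => hc.mem_of_mem hX hgen u (v := w)
  have h1 : ∀ v u w, u ∈ X → w ∈ X → CubeAt c v u w := by
    intro v u w hu hw
    have hv : v ∈ Submonoid.closure X := hgen ▸ Submonoid.mem_top v
    induction hv using Submonoid.closure_induction_right generalizing u w with
    | one =>
      rw [CubeAt, hc.one_left, hc.one_left, hc.one_right, hc.one_left]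
      exact hc.equiv_refl _
    | mul_right x _ y hy ih =>
      exact hc.cubeAt_mul hX hgen hcube hw (ih _ _ hu hw) (hcube _ hy _ (hm _ hu) _ (hm _ hw))
  have hu : u ∈ Submonoid.closure X := hgen ▸ Submonoid.mem_top u
  induction hu using Submonoid.closure_induction_right generalizing v w with
  | one =>
    rw [CubeAt, hc.one_left, hc.one_left, hc.one_right, hc.one_left]
    exact hc.equiv_refl _
  | mul_right x _ y hy ih =>
    exact hc.cubeAt_mul hX hgen hcube hw (ih _ hw) (h1 _ _ _ hy (hm _ hw)).symm

/-- The cube property extends from a generating set closed under complement to the whole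
monoid. -/
theorem cubeAt_of_closure (u v w : W) : CubeAt c u v w := by
  have hm := fun u {w} => hc.mem_of_mem hX hgen u (v := w)
  have hr := fun u v {w} => hc.cubeAt_of_mem_right hX hgen hcube u v (w := w)
  -- The induction is on the total length, because the step needs cubes with the three arguments
  -- permuted.
  have key : ∀ n i j k : ℕ, i + j + k = n → ∀ u ∈ X ^ i, ∀ v ∈ X ^ j, ∀ w ∈ X ^ k,
      CubeAt c u v w := by
    intro n
    induction n with
    | zero =>
      intro i j k h u _ v _ w hw
      obtain rfl : k = 0 := by omega
      rw [pow_zero, Set.mem_one] at hw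
      rw [hw, CubeAt]
      simp only [hc.one_right]
      exact hc.equiv_refl 1
    | succ n ih =>
      intro i j k h u hu v hv w hw
      rcases k with _ | k
      · rw [pow_zero, Set.mem_one] at hw
        rw [hw, CubeAt]
        simp only [hc.one_right]
        exact hc.equiv_refl 1
      rw [pow_succ] at hw
      obtain ⟨w₁, hw₁, w₂, hw₂, rfl⟩ := hw
      change CubeAt c u v (w₁ * w₂)
      rw [CubeAt, hc.mul_right u, hc.mul_right v, hc.mul_right, hc.mul_right]
      refine hc.equiv_mul (ih i j k (by omega) u hu v hv w₁ hw₁) ?_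
      -- The cubes at `u, w₁, v` and `v, w₁, u` move each side to a complement taken after `w₁`;
      -- there the cube at `w₁ \ u`, `w₁ \ v`, `w₂` compares them.
      have e1 := hc.equiv_left (hr _ _ (hm (c w₁ u) hw₂))
        (ih i k j (by omega) u hu w₁ hw₁ v hv)
      have e2 := hc.equiv_left (hr _ _ (hm (c w₁ v) hw₂))
        (ih j k i (by omega) v hv w₁ hw₁ u hu)
      have e3 := hr (c w₁ u) (c w₁ v) hw₂
      have t := fun {u v w} => hc.equiv_trans_of_mem hcube (u := u) (v := v) (w := w)
      have m3 : ∀ x y, c x (c y w₂) ∈ X := fun x y => hm _ (hm _ hw₂)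
      exact t (m3 _ _) (m3 _ _) (m3 _ _) (t (m3 _ _) (m3 _ _) (m3 _ _) e1 e3) e2.symm
  obtain ⟨i, hi⟩ := exists_mem_pow_of_closure_eq_top hgen u
  obtain ⟨j, hj⟩ := exists_mem_pow_of_closure_eq_top hgen v
  obtain ⟨k, hk⟩ := exists_mem_pow_of_closure_eq_top hgen w
  exact key _ i j k rfl u hi v hj w hk

end Extension

end IsComplementOp

end Complement

/-! ### Complements in monoids with right lcm's -/

section LcmMonoid

open scoped Pointwise

variable {M : Type v} [Monoid M]

theorem finite_pow {S : Set M} (hS : S.Finite) (n : ℕ) : (S ^ n).Finite := by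
  induction n with
  | zero => simp
  | succ n ih => rw [pow_succ]; exact ih.mul hS

theorem LeftDvd.refl (x : M) : LeftDvd x x := ⟨1, mul_one x⟩

theorem LeftDvd.trans {x y z : M} (h : LeftDvd x y) (h' : LeftDvd y z) : LeftDvd x z := by
  obtain ⟨a, rfl⟩ := h
  obtain ⟨b, rfl⟩ := h'
  exact ⟨a * b, (mul_assoc _ _ _).symm⟩

theorem leftDvd_mul (x y : M) : LeftDvd x (x * y) := ⟨y, rfl⟩

theorem LeftDvd.mul_left {x y : M} (h : LeftDvd x y) (z : M) : LeftDvd (z * x) (z * y) := by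
  obtain ⟨a, rfl⟩ := h
  exact ⟨a, mul_assoc _ _ _⟩

theorem IsRightLcm.symm {x y z : M} (h : IsRightLcm x y z) : IsRightLcm y x z :=
  ⟨h.2.1, h.1, fun t ht ht' => h.2.2 t ht' ht⟩

variable (M) in
/-- Left cancellative monoids without nontrivial units where any two elements have a right lcm. -/
structure IsLcmMonoid : Prop where
  left_cancel : ∀ {x y z : M}, x * y = x * z → y = z
  conical : ∀ {x y : M}, x * y = 1 → y = 1
  exists_complement : ∀ x y : M, ∃ z, IsRightComplement x y z

namespace IsLcmMonoid

variable (h : IsLcmMonoid M)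
include h

theorem conical_left {x y : M} (hxy : x * y = 1) : x = 1 := by
  have := h.conical hxy
  rwa [this, mul_one] at hxy

theorem antisymm {x y : M} (hxy : LeftDvd x y) (hyx : LeftDvd y x) : x = y := by
  obtain ⟨a, rfl⟩ := hxy
  obtain ⟨b, hb⟩ := hyx
  have h1 : a * b = 1 := h.left_cancel (x := x) (by rw [← mul_assoc, hb, mul_one])
  rw [h.conical_left h1, mul_one]

theorem lcm_unique {x y z z' : M} (hz : IsRightLcm x y z) (hz' : IsRightLcm x y z') : z = z' :=
  h.antisymm (hz.2.2 _ hz'.1 hz'.2.1) (hz'.2.2 _ hz.1 hz.2.1)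

theorem leftDvd_of_mul {x y z : M} (hd : LeftDvd (x * y) (x * z)) : LeftDvd y z := by
  obtain ⟨a, ha⟩ := hd
  exact ⟨a, h.left_cancel (by rw [← mul_assoc, ha])⟩

/-- The right complement `x \ y`. -/
noncomputable def compl (x y : M) : M := (h.exists_complement x y).choose

theorem isRightLcm_compl (x y : M) : IsRightLcm x y (x * h.compl x y) :=
  (h.exists_complement x y).choose_spec

theorem eq_compl {x y z : M} (hz : IsRightLcm x y (x * z)) : z = h.compl x y :=
  h.left_cancel (h.lcm_unique hz (h.isRightLcm_compl x y))

theorem mul_compl_comm (x y : M) : x * h.compl x y = y * h.compl y x :=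
  h.lcm_unique (h.isRightLcm_compl x y) (h.isRightLcm_compl y x).symm

theorem mul_compl_of_leftDvd {x y : M} (hd : LeftDvd x y) : x * h.compl x y = y :=
  h.antisymm ((h.isRightLcm_compl x y).2.2 _ hd (.refl y)) (h.isRightLcm_compl x y).2.1

theorem compl_mul (x y : M) : h.compl x (x * y) = y :=
  h.left_cancel (h.mul_compl_of_leftDvd (leftDvd_mul x y))

theorem compl_eq_one_iff {x y : M} : h.compl y x = 1 ↔ LeftDvd x y := by
  have h1 := h.isRightLcm_compl y x
  constructor
  · intro hd
    rw [hd, mul_one] at h1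
    exact h1.2.1
  · intro hd
    exact (h.eq_compl (by rw [mul_one]; exact ⟨.refl y, hd, fun _ ht _ => ht⟩)).symm

theorem isComplementOp : IsComplementOp h.compl where
  one_left v := by simpa using h.compl_mul 1 v
  one_right v := h.compl_eq_one_iff.2 (by simpa using leftDvd_mul 1 v)
  self v := h.compl_eq_one_iff.2 (.refl v)
  mul_left u v w := by
    symm
    apply h.eq_compl
    have h1 := h.isRightLcm_compl u w
    have h2 := h.isRightLcm_compl v (h.compl u w)
    refine ⟨leftDvd_mul _ _, ?_, ?_⟩
    · rw [mul_assoc]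
      exact h1.2.1.trans (h2.2.1.mul_left u)
    · rintro t ⟨s, rfl⟩ hw
      rw [mul_assoc] at hw ⊢
      rw [mul_assoc]
      exact (h2.2.2 _ (leftDvd_mul v s)
        (h.leftDvd_of_mul (h1.2.2 _ (leftDvd_mul _ _) hw))).mul_left u
  mul_right w u v := by
    symm
    apply h.eq_compl
    have h1 := h.isRightLcm_compl u w
    have h2 := h.isRightLcm_compl (h.compl u w) v
    refine ⟨leftDvd_mul _ _, ?_, ?_⟩
    · rw [← mul_assoc, h.mul_compl_comm w u, mul_assoc]
      exact h2.2.1.mul_left u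
    · rintro t hw ⟨s, rfl⟩
      rw [← mul_assoc, h.mul_compl_comm w u, mul_assoc]
      rw [mul_assoc] at hw ⊢
      exact (h2.2.2 _ (h.leftDvd_of_mul (h1.2.2 _ (leftDvd_mul _ _) hw))
        (leftDvd_mul v s)).mul_left u

/-- After multiplication by `x` on the left, both sides describe the lcm of `x`, `y` and `z`. -/
theorem isRightLcm_compl_compl (x : M) {y z m : M} (hm : IsRightLcm y z m) :
    IsRightLcm (h.compl x y) (h.compl x z) (h.compl x m) := by
  have key : ∀ y, LeftDvd y m → LeftDvd (h.compl x y) (h.compl x m) := fun y hy =>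
    h.leftDvd_of_mul ((h.isRightLcm_compl x y).2.2 _ (leftDvd_mul _ _)
      (hy.trans (h.isRightLcm_compl x m).2.1))
  refine ⟨key y hm.1, key z hm.2.1, fun t hy hz => h.leftDvd_of_mul (x := x) ?_⟩
  refine (h.isRightLcm_compl x m).2.2 _ (leftDvd_mul _ _) (hm.2.2 _ ?_ ?_)
  · exact (h.isRightLcm_compl x y).2.1.trans (hy.mul_left x)
  · exact (h.isRightLcm_compl x z).2.1.trans (hz.mul_left x)

end IsLcmMonoid

/-! ### From a permuting upper bound to a Garside monoid -/

section Garside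

variable (h : IsLcmMonoid M) {S : Set M} {Δ : M}

/-- In an lcm monoid, a generating set closed under complement on which the complement to an upper
bound `Δ` is a permutation makes a power of `Δ` central. -/
theorem exists_central_pow (hfin : S.Finite) (hgen : Submonoid.closure S = ⊤)
    (hdvd : ∀ s ∈ S, LeftDvd s Δ) (hmaps : ∀ s ∈ S, h.compl s Δ ∈ S)
    (hsurj : ∀ s ∈ S, ∃ t ∈ S, h.compl t Δ = s) :
    ∃ k : ℕ, ∀ x, x * Δ ^ (k + 1) = Δ ^ (k + 1) * x := by
  have : Finite S := hfin
  let φ : S → S := fun s => ⟨h.compl s Δ, hmaps s s.2⟩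
  have hφ : Function.Surjective φ := fun s => by
    obtain ⟨t, ht, hts⟩ := hsurj s s.2
    exact ⟨⟨t, ht⟩, Subtype.ext hts⟩
  have hφb : Function.Bijective φ := ⟨Finite.injective_iff_surjective.2 hφ, hφ⟩
  let e : Equiv.Perm S := Equiv.ofBijective φ hφb
  have hΔ : ∀ s : S, (s : M) * (e s : M) = Δ := fun s => h.mul_compl_of_leftDvd (hdvd s s.2)
  -- `s Δ = s e(s) e²(s) = Δ e²(s)`; the permutation `e²` of a finite set has finite order.
  have hcomm : ∀ s : S, (s : M) * Δ = Δ * ((e ^ 2) s : S) := fun s => by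
    rw [pow_two, Equiv.Perm.mul_apply, ← hΔ (e s), ← mul_assoc, hΔ s, hΔ (e s)]
  have hpow : ∀ (n : ℕ) (s : S), (s : M) * Δ ^ n = Δ ^ n * (((e ^ 2) ^ n) s : S) := by
    intro n
    induction n with
    | zero => simp
    | succ n ih =>
      intro s
      rw [pow_succ Δ, ← mul_assoc, ih, mul_assoc, hcomm, ← mul_assoc, pow_succ' (e ^ 2),
        Equiv.Perm.mul_apply]
  obtain ⟨n, hn, hn'⟩ := isOfFinOrder_iff_pow_eq_one.1 (isOfFinOrder_of_finite (e ^ 2))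
  refine ⟨n - 1, fun x => ?_⟩
  rw [Nat.sub_add_cancel hn]
  have hx : x ∈ Submonoid.closure S := hgen ▸ Submonoid.mem_top x
  induction hx using Submonoid.closure_induction with
  | mem s hs => simpa [hn'] using hpow n ⟨s, hs⟩
  | one => simp
  | mul x y _ _ hx hy => rw [mul_assoc, hy, ← mul_assoc, hx, mul_assoc]

variable (hgen : Submonoid.closure S = ⊤)

include h hgen in
-- A factor `s` on the right is completed to `Δ`, then to the central power, which moves to the left
-- and cancels there.
theorem right_cancel_of_central (hdvd : ∀ s ∈ S, LeftDvd s Δ) {k : ℕ}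
    (hk : ∀ x, x * Δ ^ (k + 1) = Δ ^ (k + 1) * x) {x y z : M} (hxy : x * z = y * z) : x = y := by
  have hz : z ∈ Submonoid.closure S := hgen ▸ Submonoid.mem_top z
  induction hz using Submonoid.closure_induction generalizing x y with
  | mem s hs =>
    obtain ⟨t, ht⟩ := hdvd s hs
    apply h.left_cancel (x := Δ ^ (k + 1))
    rw [← hk, ← hk, pow_succ', ← mul_assoc, ← mul_assoc]
    congr 1
    rw [← ht, ← mul_assoc, ← mul_assoc, hxy]
  | one => simpa using hxy
  | mul a b _ _ ha hb => exact ha (hb (by simpa only [mul_assoc] using hxy))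

include hgen in
theorem exists_central_multiple (hdvd : ∀ s ∈ S, LeftDvd s Δ) {k : ℕ}
    (hk : ∀ x, x * Δ ^ (k + 1) = Δ ^ (k + 1) * x) (x : M) :
    ∃ e : M, (∀ t, t * e = e * t) ∧ LeftDvd x e := by
  have hx : x ∈ Submonoid.closure S := hgen ▸ Submonoid.mem_top x
  induction hx using Submonoid.closure_induction with
  | mem s hs => exact ⟨_, hk, (hdvd s hs).trans (pow_succ' Δ k ▸ leftDvd_mul _ _)⟩
  | one => exact ⟨1, by simp, .refl 1⟩
  | mul x y _ _ hx hy =>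
    obtain ⟨e, he, x', rfl⟩ := hx
    obtain ⟨e', he', y', rfl⟩ := hy
    refine ⟨x * x' * (y * y'), fun t => ?_, y' * x', ?_⟩
    · rw [← mul_assoc t, he, mul_assoc, he', ← mul_assoc]
    · rw [mul_assoc x x', he' x', mul_assoc, mul_assoc]

/-- A norm on a monoid: it strictly decreases when going to proper factors. -/
structure IsStrictNorm (ν : M → ℕ) : Prop where
  lt_mul_left : ∀ {x : M}, x ≠ 1 → ∀ y, ν y < ν (x * y)
  lt_mul_right : ∀ {y : M}, y ≠ 1 → ∀ x, ν x < ν (x * y)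

/-- Right divisors of `y` divide `x * y`, but `x * y` is a new one. Right multiplication by `y`
embeds the right divisors of `x` in those of `x * y` and misses `1`. -/
theorem isStrictNorm_ncard (hcon : ∀ {x y : M}, x * y = 1 → y = 1)
    (hcan : ∀ {x y z : M}, x * z = y * z → x = y)
    (hfd : ∀ x : M, {d | RightDvd d x}.Finite) :
    IsStrictNorm (fun x : M => {d | RightDvd d x}.ncard) where
  lt_mul_left {x} hx y := by
    refine Set.ncard_lt_ncard ⟨?_, fun hsub => hx ?_⟩ (hfd _)
    · rintro d ⟨z, rfl⟩
      exact ⟨x * z, mul_assoc _ _ _⟩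
    · obtain ⟨z, hz⟩ := hsub (show RightDvd (x * y) (x * y) from ⟨1, one_mul _⟩)
      exact hcon (x := z) (hcan (z := y) (by rw [mul_assoc, hz, one_mul]))
  lt_mul_right {y} hy x := by
    rw [← Set.ncard_image_of_injective _ (f := fun d => d * y) (fun a b hab => hcan hab)]
    refine Set.ncard_lt_ncard ⟨?_, fun hsub => hy ?_⟩ (hfd _)
    · rintro _ ⟨d, ⟨z, rfl⟩, rfl⟩
      exact ⟨z, (mul_assoc _ _ _).symm⟩
    · obtain ⟨d, -, hd⟩ := hsub (show RightDvd 1 (x * y) from ⟨x * y, mul_one _⟩)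
      exact hcon hd

theorem IsStrictNorm.isAtomicMonoid {ν : M → ℕ} (hν : IsStrictNorm ν) : IsAtomicMonoid M where
  generated := by
    rw [eq_top_iff]
    intro x _
    induction hn : ν x using Nat.strong_induction_on generalizing x with
    | _ n ih =>
      subst hn
      by_cases hx : x = 1
      · rw [hx]; exact one_mem _
      by_cases ha : IsAtomElt x
      · exact Submonoid.subset_closure ha
      · simp only [IsAtomElt, not_and, not_forall, not_or] at ha
        obtain ⟨y, z, rfl, hy, hz⟩ := ha hx
        exact mul_mem (ih _ (hν.lt_mul_right hz y) trivial rfl)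
          (ih _ (hν.lt_mul_left hy z) trivial rfl)
  norm_finite x := by
    refine ⟨ν x, fun l hl hx => ?_⟩
    subst hx
    induction l with
    | nil => simp
    | cons a l ih =>
      have h1 := ih (fun b hb => hl b (List.mem_cons_of_mem _ hb))
      have h2 := hν.lt_mul_left (hl a List.mem_cons_self).1 l.prod
      rw [List.prod_cons, List.length_cons]
      omega

include h in
-- A common divisor of greatest norm absorbs any other, since their lcm is again a common divisor.
theorem IsStrictNorm.exists_leftGcd {ν : M → ℕ} (hν : IsStrictNorm ν) (x y : M) :
    ∃ z, IsLeftGcd x y z := by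
  have hb : ∀ d, LeftDvd d x → ν d ≤ ν x := by
    rintro d ⟨z, rfl⟩
    by_cases hz : z = 1
    · simp [hz]
    · exact (hν.lt_mul_right hz d).le
  let P : ℕ → Prop := fun n => ∃ d, LeftDvd d x ∧ LeftDvd d y ∧ ν d = n
  classical
  have h1 : LeftDvd 1 x := ⟨x, one_mul x⟩
  have hP : P (Nat.findGreatest P (ν x)) :=
    Nat.findGreatest_spec (hb 1 h1) ⟨1, h1, ⟨y, one_mul y⟩, rfl⟩
  obtain ⟨d, hx, hy, hd⟩ := hP
  refine ⟨d, hx, hy, fun t htx hty => ?_⟩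
  have hl := h.isRightLcm_compl d t
  have hm : LeftDvd (d * h.compl d t) x := hl.2.2 _ hx htx
  have hle := Nat.le_findGreatest (P := P) (hb _ hm) ⟨_, hm, hl.2.2 _ hy hty, rfl⟩
  rw [← hd] at hle
  have : h.compl d t = 1 := by
    by_contra hne
    exact absurd (hν.lt_mul_right hne d) (not_lt.2 hle)
  exact h.compl_eq_one_iff.1 this

include h in
-- Passing to cofactors in `e = x' x = y' y` reverses divisibility, so the gcd is the cofactor of
-- the right lcm of `x'` and `y'`.
theorem IsLcmMonoid.exists_rightGcd (hcan : ∀ {x y z : M}, x * z = y * z → x = y)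
    (hmul : ∀ x y : M, ∃ e, RightDvd x e ∧ RightDvd y e) (x y : M) :
    ∃ z, IsRightGcd x y z := by
  obtain ⟨e, ⟨x', hx'⟩, y', hy'⟩ := hmul x y
  have hm := h.isRightLcm_compl x' y'
  obtain ⟨g, hg⟩ := hm.2.2 e ⟨x, hx'⟩ ⟨y, hy'⟩
  refine ⟨g, ?_, ?_, ?_⟩
  · refine ⟨h.compl x' y', h.left_cancel (x := x') ?_⟩
    rw [← mul_assoc, hg, hx']
  · obtain ⟨p, hp⟩ := hm.2.1
    refine ⟨p, h.left_cancel (x := y') ?_⟩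
    rw [← mul_assoc, hp, hg, hy']
  · rintro t ⟨a, rfl⟩ ⟨b, rfl⟩
    have hab : x' * a = y' * b := hcan (z := t) (by rw [mul_assoc, hx', mul_assoc, hy'])
    obtain ⟨q, hq⟩ := hm.2.2 (x' * a) (leftDvd_mul _ _) (hab ▸ leftDvd_mul _ _)
    refine ⟨q, h.left_cancel (x := x' * h.compl x' y') ?_⟩
    rw [← mul_assoc, hq, hg, mul_assoc, hx']

theorem IsStrictNorm.exists_leftLcm {ν : M → ℕ} (hν : IsStrictNorm ν)
    (hgcd : ∀ x y : M, ∃ z, IsRightGcd x y z)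
    (hmul : ∀ x y : M, ∃ e, RightDvd x e ∧ RightDvd y e) (x y : M) :
    ∃ z, IsLeftLcm x y z := by
  have hex : ∃ n, ∃ m, RightDvd x m ∧ RightDvd y m ∧ ν m = n := by
    obtain ⟨e, hx, hy⟩ := hmul x y
    exact ⟨_, e, hx, hy, rfl⟩
  classical
  obtain ⟨m, hx, hy, hm⟩ := Nat.find_spec hex
  refine ⟨m, hx, hy, fun t htx hty => ?_⟩
  obtain ⟨g, ⟨a, ha⟩, hgt, hg⟩ := hgcd m t
  have hle := Nat.find_min' hex ⟨g, hg x hx htx, hg y hy hty, rfl⟩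
  rw [← hm] at hle
  have ha1 : a = 1 := by
    by_contra hne
    have := hν.lt_mul_left hne g
    rw [ha] at this
    omega
  rw [ha1, one_mul] at ha
  exact ha ▸ hgt

include h in
theorem IsLcmMonoid.rightDvd_of_central {e x : M} (he : ∀ t, t * e = e * t) (hx : LeftDvd x e) :
    RightDvd x e := by
  obtain ⟨z, rfl⟩ := hx
  exact ⟨z, h.left_cancel (x := x) (by rw [he, mul_assoc])⟩

/-- An lcm monoid is a Garside monoid when it is generated by a finite set that is closed under
complement and has an upper bound `Δ` in the set such that the complement to `Δ` is surjective. -/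
theorem IsLcmMonoid.isGarside (hfin : S.Finite) (hgen : Submonoid.closure S = ⊤)
    (hS : ∀ x ∈ S, ∀ y ∈ S, h.compl x y ∈ S) (hΔ : Δ ∈ S)
    (hdvd : ∀ s ∈ S, LeftDvd s Δ) (hsurj : ∀ s ∈ S, ∃ t ∈ S, h.compl t Δ = s) :
    IsGarside M := by
  have hc := h.isComplementOp
  obtain ⟨k, hk⟩ := exists_central_pow h hfin hgen hdvd (fun s hs => hS s hs Δ hΔ) hsurj
  have hcan : ∀ {x y z : M}, x * z = y * z → x = y := right_cancel_of_central h hgen hdvd hk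
  have hfd : ∀ x : M, {d | RightDvd d x}.Finite := by
    intro x
    obtain ⟨n, hn⟩ := exists_mem_pow_of_closure_eq_top hgen x
    refine (finite_pow hfin n).subset ?_
    rintro d ⟨z, rfl⟩
    -- `d = z \ (z d)`, and complements stay in `S ^ n`.
    have := hc.mem_pow_of_mem_pow hS hgen z hn
    rwa [h.compl_mul] at this
  have hmul : ∀ x y : M, ∃ e, RightDvd x e ∧ RightDvd y e := by
    intro x y
    obtain ⟨e, he, hx⟩ := exists_central_multiple hgen hdvd hk x
    obtain ⟨e', he', hy⟩ := exists_central_multiple hgen hdvd hk y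
    obtain ⟨a, ha⟩ := h.rightDvd_of_central he hx
    obtain ⟨b, hb⟩ := h.rightDvd_of_central he' hy
    refine ⟨e * e', ⟨e' * a, ?_⟩, ⟨e * b, ?_⟩⟩
    · rw [mul_assoc, ha, he]
    · rw [mul_assoc, hb]
  have hν := isStrictNorm_ncard h.conical hcan hfd
  have hgcd := h.exists_rightGcd hcan hmul
  have hright : ∀ {x}, RightDvd x Δ → x ∈ S := by
    rintro x ⟨z, hz⟩
    have := hc.mem_of_mem hS hgen z hΔ
    rwa [← hz, h.compl_mul] at this
  have hleft : ∀ {x}, LeftDvd x Δ ↔ x ∈ S := by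
    refine ⟨?_, hdvd _⟩
    rintro ⟨z, hz⟩
    -- The cofactor `z` is `t \ Δ` with `t ∈ S`; then `t z = Δ = x z` forces `x = t`.
    obtain ⟨t, ht, htz⟩ := hsurj z (hright ⟨_, hz⟩)
    have h1 := h.mul_compl_of_leftDvd (hdvd t ht)
    rw [htz, ← hz] at h1
    rwa [← hcan h1]
  have hset : {x | LeftDvd x Δ} = S := Set.ext fun _ => hleft
  refine ⟨⟨hν.isAtomicMonoid, ?_, fun x y => ⟨_, h.isRightLcm_compl x y⟩,
    hν.exists_leftLcm hgcd hmul, hgcd, hν.exists_leftGcd h⟩, Δ, ?_, ?_, ?_⟩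
  · exact { mul_left_cancel := fun _ _ _ => h.left_cancel, mul_right_cancel := fun _ _ _ => hcan }
  · rw [hset]
    ext s
    refine ⟨fun hs => ?_, hright⟩
    obtain ⟨t, ht, rfl⟩ := hsurj s hs
    exact ⟨t, h.mul_compl_of_leftDvd (hdvd t ht)⟩
  · rwa [hset]
  · rwa [hset]

end Garside

end LcmMonoid

/-! ### Reversing that always terminates -/

section Total

variable {A : Type u} {f : A → A → Option (FreeMonoid A)}

/-- The operation `u \_f v` on words, with value `1` where it is undefined. -/
noncomputable def wordCompl (f : A → A → Option (FreeMonoid A)) (u v : FreeMonoid A) :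
    FreeMonoid A := (under f u v).getD 1

theorem wordCompl_eq {u v w w' : FreeMonoid A} (h : RevTo f u v w w') : wordCompl f u v = w := by
  rw [wordCompl, under_eq_some.2 ⟨w', h⟩, Option.getD_some]

theorem mk_rels (u v : FreeMonoid A) (h : rels f u v) :
    PresentedMonoid.mk (rels f) u = PresentedMonoid.mk (rels f) v :=
  (Con.eq _).2 (ConGen.Rel.of _ _ h)

variable (htot : ∀ u v, ∃ w w', RevTo f u v w w')
include htot

theorem revTo_wordCompl (u v : FreeMonoid A) :
    RevTo f u v (wordCompl f u v) (wordCompl f v u) := by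
  obtain ⟨w, w', h⟩ := htot u v
  rwa [wordCompl_eq h, wordCompl_eq h.symm]

theorem under_eq_wordCompl (u v : FreeMonoid A) : under f u v = some (wordCompl f u v) :=
  under_eq_some.2 ⟨_, revTo_wordCompl htot u v⟩

theorem isComplementOp_wordCompl (hf : IsReversingFunction f) : IsComplementOp (wordCompl f) where
  one_left v := wordCompl_eq (.one_left v)
  one_right v := wordCompl_eq (.one_right v)
  self v := wordCompl_eq (.self hf v)
  mul_left _ _ _ := wordCompl_eq ((revTo_wordCompl htot _ _).mul_left (revTo_wordCompl htot _ _))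
  mul_right _ _ _ := wordCompl_eq ((revTo_wordCompl htot _ _).mul_right (revTo_wordCompl htot _ _))

theorem wordCompl_mem_underClosure {u v : FreeMonoid A} (hu : u ∈ underClosure f)
    (hv : v ∈ underClosure f) : wordCompl f u v ∈ underClosure f :=
  OpClosure.step u v _ hu hv (under_eq_wordCompl htot u v)

theorem mk_eq_mk_of_complEquiv {u v : FreeMonoid A} (h : ComplEquiv (wordCompl f) u v) :
    PresentedMonoid.mk (rels f) u = PresentedMonoid.mk (rels f) v := by
  have h1 := revTo_wordCompl htot u v
  rw [h.1, h.2] at h1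
  simpa using h1.map_mul_eq mk_rels

end Total

/-! ### Models of reversing and finiteness of the join closure -/

section Model

open scoped Pointwise

variable {A : Type u} {f : A → A → Option (FreeMonoid A)} {M : Type v} [Monoid M]

theorem closure_underClosure : Submonoid.closure (underClosure f) = ⊤ := by
  refine top_le_iff.1 ?_
  rw [← FreeMonoid.closure_range_of]
  exact Submonoid.closure_mono fun x hx => .base x hx

/-- The homomorphism `π` maps words onto a left cancellative monoid where reversing computes right
lcm's, and only the empty word to `1`. -/
structure IsReversingModel (f : A → A → Option (FreeMonoid A)) (π : FreeMonoid A →* M) : Prop where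
  surjective : Function.Surjective π
  left_cancel : ∀ {x y z : M}, x * y = x * z → y = z
  eq_one : ∀ {w}, π w = 1 → w = 1
  under_lcm : ∀ u v, ∃ w, under f u v = some w ∧ IsRightLcm (π u) (π v) (π u * π w)

namespace IsReversingModel

variable {π : FreeMonoid A →* M} (hm : IsReversingModel f π)
include hm

theorem isLcmMonoid : IsLcmMonoid M where
  left_cancel := hm.left_cancel
  conical := by
    intro x y hxy
    obtain ⟨u, rfl⟩ := hm.surjective x
    obtain ⟨v, rfl⟩ := hm.surjective y
    rw [← map_mul] at hxy
    have h1 := congrArg FreeMonoid.toList (hm.eq_one hxy)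
    have h2 : v.toList = [] := (List.append_eq_nil_iff.1 h1).2
    have h3 : v = 1 := FreeMonoid.toList.injective h2
    rw [h3, map_one]
  exists_complement := by
    intro x y
    obtain ⟨u, rfl⟩ := hm.surjective x
    obtain ⟨v, rfl⟩ := hm.surjective y
    obtain ⟨w, -, hw⟩ := hm.under_lcm u v
    exact ⟨_, hw⟩

theorem total (u v : FreeMonoid A) : ∃ w w', RevTo f u v w w' := by
  obtain ⟨w, hw, -⟩ := hm.under_lcm u v
  exact ⟨w, under_eq_some.1 hw⟩

theorem map_wordCompl (u v : FreeMonoid A) :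
    π (wordCompl f u v) = hm.isLcmMonoid.compl (π u) (π v) := by
  obtain ⟨w, hw, h⟩ := hm.under_lcm u v
  rw [under_eq_wordCompl hm.total, Option.some.injEq] at hw
  subst hw
  exact hm.isLcmMonoid.eq_compl h

theorem isRightLcm_wordCompl (u v : FreeMonoid A) :
    IsRightLcm (π u) (π v) (π (u * wordCompl f u v)) := by
  rw [map_mul, hm.map_wordCompl]
  exact hm.isLcmMonoid.isRightLcm_compl _ _

theorem under_eq_one_iff {u v : FreeMonoid A} :
    under f u v = some 1 ↔ LeftDvd (π v) (π u) := by
  rw [under_eq_wordCompl hm.total, Option.some.injEq, ← hm.isLcmMonoid.compl_eq_one_iff,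
    ← hm.map_wordCompl]
  exact ⟨fun h => by rw [h, map_one], hm.eq_one⟩

theorem equivPP_iff {u v : FreeMonoid A} : EquivPP f (some u) (some v) ↔ π u = π v := by
  rw [EquivPP, hm.under_eq_one_iff, hm.under_eq_one_iff]
  exact ⟨fun h => hm.isLcmMonoid.antisymm h.2 h.1, fun h => h ▸ ⟨.refl _, .refl _⟩⟩

theorem join_eq (u v : FreeMonoid A) : join f u v = some (u * wordCompl f u v) := by
  rw [join, under_eq_wordCompl hm.total, Option.map_some]

theorem definedOn_join (X : Set (FreeMonoid A)) : DefinedOn (join f) X :=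
  fun u _ v _ => ⟨_, hm.join_eq u v⟩

theorem mul_wordCompl_mem_joinClosure {u v : FreeMonoid A} (hu : u ∈ joinClosure f)
    (hv : v ∈ joinClosure f) : u * wordCompl f u v ∈ joinClosure f :=
  OpClosure.step u v _ hu hv (hm.join_eq u v)

theorem compl_mem_underValues (x : M) {y : M} (hy : y ∈ π '' underClosure f) :
    hm.isLcmMonoid.compl x y ∈ π '' underClosure f := by
  refine hm.isLcmMonoid.isComplementOp.mem_of_mem ?_ ?_ x hy
  · rintro _ ⟨u, hu, rfl⟩ _ ⟨v, hv, rfl⟩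
    exact ⟨_, wordCompl_mem_underClosure hm.total hu hv, hm.map_wordCompl u v⟩
  · rw [← MonoidHom.map_mclosure, closure_underClosure, ← MonoidHom.mrange_eq_map]
    exact MonoidHom.mrange_eq_top.2 hm.surjective

theorem closure_joinValues : Submonoid.closure (π '' joinClosure f) = ⊤ := by
  rw [← MonoidHom.map_mclosure, show Submonoid.closure (joinClosure f) = ⊤ from
    top_le_iff.1 (closure_underClosure.symm.le.trans
      (Submonoid.closure_mono fun x hx => .base x hx)), ← MonoidHom.mrange_eq_map]
  exact MonoidHom.mrange_eq_top.2 hm.surjective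

theorem compl_mem_joinValues (x : M) {y : M} (hy : y ∈ π '' joinClosure f) :
    hm.isLcmMonoid.compl x y ∈ π '' joinClosure f := by
  obtain ⟨u, hu, rfl⟩ := hy
  induction hu with
  | base u hu =>
    obtain ⟨v, hv, h⟩ := hm.compl_mem_underValues x ⟨u, hu, rfl⟩
    exact ⟨v, .base v hv, h⟩
  | step u v w _ _ hw ihu ihv =>
    rw [hm.join_eq, Option.some.injEq] at hw
    subst hw
    have h := hm.isLcmMonoid.isRightLcm_compl_compl x (hm.isRightLcm_wordCompl u v)
    obtain ⟨p, hp, hpu⟩ := ihu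
    obtain ⟨q, hq, hqv⟩ := ihv
    rw [← hpu, ← hqv] at h
    exact ⟨_, hm.mul_wordCompl_mem_joinClosure hp hq,
      hm.isLcmMonoid.lcm_unique (hm.isRightLcm_wordCompl p q) h⟩

/-- An iterated lcm is determined by the elements of the first closure dividing it, so values embed
in a finite power set. -/
theorem finite_joinValues (hfin : (underClosure f).Finite) : (π '' joinClosure f).Finite := by
  have key : ∀ s ∈ π '' joinClosure f, ∀ t,
      (∀ x ∈ π '' underClosure f, LeftDvd x s → LeftDvd x t) → LeftDvd s t := by
    rintro _ ⟨u, hu, rfl⟩ t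
    induction hu with
    | base u hu => exact fun h => h _ ⟨u, hu, rfl⟩ (.refl _)
    | step u v w _ _ hw ihu ihv =>
      intro h
      rw [hm.join_eq, Option.some.injEq] at hw
      subst hw
      have hl := hm.isRightLcm_wordCompl u v
      exact hl.2.2 t (ihu fun x hx hd => h x hx (hd.trans hl.1))
        (ihv fun x hx hd => h x hx (hd.trans hl.2.1))
  have hX := hfin.image π
  refine Set.Finite.of_finite_image (f := fun s => {x ∈ π '' underClosure f | LeftDvd x s})
    (hX.powerset.subset ?_) ?_
  · rintro _ ⟨s, -, rfl⟩
    exact Set.sep_subset _ _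
  · intro s hs t ht (hst : {x ∈ π '' underClosure f | LeftDvd x s} =
      {x ∈ π '' underClosure f | LeftDvd x t})
    exact hm.isLcmMonoid.antisymm
      (key s hs t fun x hx hd => (hst.subset ⟨hx, hd⟩).2)
      (key t ht s fun x hx hd => (hst.symm.subset ⟨hx, hd⟩).2)

end IsReversingModel

/-- The words obtained from the empty word by appending elements of `X` and staying in `J`. -/
inductive BuiltFrom (X J : Set (FreeMonoid A)) : FreeMonoid A → Prop
  | one : BuiltFrom X J 1
  | mul (v x : FreeMonoid A) (hv : BuiltFrom X J v) (hx : x ∈ X) (h : v * x ∈ J) :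
      BuiltFrom X J (v * x)

namespace IsReversingModel

variable {π : FreeMonoid A →* M} (hm : IsReversingModel f π)
include hm

/-- In `u \ (v x) = (u \ v) ((v \ u) \ x)` the last factor stays in the closure, and each prefix of
the join is itself the join of `u` with a prefix in the set. -/
theorem builtFrom_of_mem_joinClosure (hf : IsReversingFunction f) {w : FreeMonoid A}
    (hw : w ∈ joinClosure f) : BuiltFrom (underClosure f) (joinClosure f) w := by
  have hc := isComplementOp_wordCompl hm.total hf
  induction hw with
  | base u hu => exact one_mul u ▸ .mul 1 u .one hu ((one_mul u).symm ▸ .base u hu)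
  | step u v w hu hv hw ihu ihv =>
    rw [hm.join_eq, Option.some.injEq] at hw
    subst hw
    clear hv
    induction ihv with
    | one => rwa [hc.one_right, mul_one]
    | mul v x _ hx h ih =>
      have h1 := hm.mul_wordCompl_mem_joinClosure hu h
      rw [hc.mul_right, ← mul_assoc] at h1 ⊢
      exact .mul _ _ ih (hc.mem_of_mem (fun _ hu _ hv => wordCompl_mem_underClosure hm.total hu hv)
        closure_underClosure _ hx) h1

/-- Appending a nonempty factor strictly enlarges the set of left divisors among the finitely many
values: the new value is one of them. -/
theorem exists_mem_pow_of_builtFrom (hfin : (π '' joinClosure f).Finite) {w : FreeMonoid A}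
    (hw : BuiltFrom (underClosure f) (joinClosure f) w) :
    ∃ n ≤ {s ∈ π '' joinClosure f | LeftDvd s (π w)}.ncard, w ∈ underClosure f ^ n := by
  induction hw with
  | one => exact ⟨0, Nat.zero_le _, by simp⟩
  | mul v x _ hx h ih =>
    by_cases h1 : x = 1
    · rwa [h1, mul_one]
    obtain ⟨n, hn, hv⟩ := ih
    refine ⟨n + 1, lt_of_le_of_lt hn (Set.ncard_lt_ncard ⟨?_, fun hsub => h1 ?_⟩
      (hfin.subset (Set.sep_subset _ _))), pow_succ (underClosure f) n ▸ Set.mul_mem_mul hv hx⟩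
    · exact fun s hs => ⟨hs.1, hs.2.trans (map_mul π v x ▸ leftDvd_mul _ _)⟩
    · have h2 := (hsub ⟨⟨_, h, rfl⟩, .refl _⟩).2
      have h3 := hm.isLcmMonoid.antisymm h2 (map_mul π v x ▸ leftDvd_mul _ _)
      refine hm.eq_one (hm.left_cancel (x := π v) ?_)
      rw [← map_mul, h3, mul_one]

theorem finite_joinClosure [Nonempty A] (hf : IsReversingFunction f)
    (hfin : (underClosure f).Finite) : (joinClosure f).Finite := by
  have hS := hm.finite_joinValues hfin
  -- Since `a \ a` is empty, powers of the closure increase, and one exponent serves all words.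
  have h1 : (1 : FreeMonoid A) ∈ underClosure f := by
    obtain ⟨a⟩ := ‹Nonempty A›
    have ha : FreeMonoid.of a ∈ underClosure f := .base _ ⟨a, rfl⟩
    exact OpClosure.step _ _ _ ha ha (under_eq_some.2 ⟨1, .self hf _⟩)
  refine (finite_pow hfin (π '' joinClosure f).ncard).subset fun w hw => ?_
  obtain ⟨n, hn, hwn⟩ := hm.exists_mem_pow_of_builtFrom hS (hm.builtFrom_of_mem_joinClosure hf hw)
  exact Set.pow_subset_pow_right h1
    (hn.trans (Set.ncard_le_ncard (Set.sep_subset _ _) hS)) hwn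

/-- The condition on the word `Ω` makes the model a Garside monoid. -/
theorem isGarside (hfin : (underClosure f).Finite) (hΩ : OmegaCondition f) : IsGarside M := by
  obtain ⟨Ω, hΩ, h⟩ := hΩ
  refine hm.isLcmMonoid.isGarside (Δ := π Ω) (hm.finite_joinValues hfin) hm.closure_joinValues
    (fun x _ y hy => hm.compl_mem_joinValues x hy) ⟨Ω, hΩ, rfl⟩ ?_ ?_
  · rintro _ ⟨u, hu, rfl⟩
    exact hm.under_eq_one_iff.1 (h u hu).1
  · rintro _ ⟨u, hu, rfl⟩
    obtain ⟨v, hv, hvu⟩ := (h u hu).2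
    rw [under_eq_wordCompl hm.total, hm.equivPP_iff, hm.map_wordCompl] at hvu
    exact ⟨_, ⟨v, hv, rfl⟩, hvu⟩

end IsReversingModel

end Model

/-! ### From a Garside monoid to the conditions on its lcm selector -/

section Selector

open scoped Pointwise

variable {A : Type u} {f : A → A → Option (FreeMonoid A)} {M : Type v} [Monoid M]

/-- The norm is the maximal length of a decomposition into atoms; concatenation makes it
superadditive. -/
theorem IsAtomicMonoid.exists_norm (h : IsAtomicMonoid M) :
    ∃ ν : M → ℕ, (∀ x y, ν x + ν y ≤ ν (x * y)) ∧ ∀ x, x ≠ 1 → 1 ≤ ν x := by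
  let L : M → Set ℕ := fun x => {n | ∃ l : List M, (∀ a ∈ l, IsAtomElt a) ∧ l.prod = x ∧
    l.length = n}
  have hne : ∀ x, (L x).Nonempty := fun x => by
    have hx : x ∈ Submonoid.closure {x : M | IsAtomElt x} := h.generated ▸ Submonoid.mem_top x
    obtain ⟨l, hl, hx⟩ := Submonoid.exists_list_of_mem_closure hx
    exact ⟨_, l, hl, hx, rfl⟩
  have hb : ∀ x, BddAbove (L x) := fun x => by
    obtain ⟨N, hN⟩ := h.norm_finite x
    refine ⟨N, ?_⟩
    rintro _ ⟨l, hl, hx, rfl⟩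
    exact hN l hl hx
  refine ⟨fun x => sSup (L x), fun x y => ?_, fun x hx => ?_⟩
  · obtain ⟨l, hl, hlx, hx⟩ := Nat.sSup_mem (hne x) (hb x)
    obtain ⟨m, hm, hmy, hy⟩ := Nat.sSup_mem (hne y) (hb y)
    refine le_csSup (hb _) ⟨l ++ m, ?_, ?_, ?_⟩
    · intro a ha
      rcases List.mem_append.1 ha with ha | ha
      · exact hl a ha
      · exact hm a ha
    · rw [List.prod_append, hlx, hmy]
    · rw [List.length_append, hx, hy]
  · obtain ⟨l, hl, hlx, hx'⟩ := Nat.sSup_mem (hne x) (hb x)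
    change 1 ≤ sSup (L x)
    rw [← hx']
    rcases l with _ | ⟨a, l⟩
    · exact absurd hlx.symm hx
    · simp

theorem IsGaussian.isLcmMonoid (h : IsGaussian M) : IsLcmMonoid M where
  left_cancel := fun hxy => h.cancel.mul_left_cancel _ hxy
  conical := by
    intro x y hxy
    obtain ⟨ν, hadd, hpos⟩ := h.atomic.exists_norm
    by_contra hy
    have h1 := hadd x y
    have h2 := hadd 1 1
    have h3 := hpos y hy
    rw [hxy] at h1
    rw [one_mul] at h2
    omega
  exists_complement := by
    intro x y
    obtain ⟨z, hz⟩ := h.right_lcm x y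
    obtain ⟨t, rfl⟩ := hz.1
    exact ⟨t, hz⟩

section

variable (h : IsLcmMonoid M) {ι : A → M} (hι : ∀ a, ι a ≠ 1)

include h hι in
theorem eq_one_of_lift_eq_one {w : FreeMonoid A} (hw : FreeMonoid.lift ι w = 1) : w = 1 := by
  induction w using FreeMonoid.inductionOn' with
  | one => rfl
  | of_mul a w _ =>
    rw [map_mul, FreeMonoid.lift_eval_of] at hw
    exact absurd (h.conical_left hw) (hι a)

theorem IsLcmSelector.map_rels (hs : IsLcmSelector ι f) (h : IsLcmMonoid M) (u v : FreeMonoid A)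
    (huv : rels f u v) : FreeMonoid.lift ι u = FreeMonoid.lift ι v := by
  obtain ⟨a, b, w, w', hw, hw', rfl, rfl⟩ := huv
  rw [map_mul, map_mul, FreeMonoid.lift_eval_of, FreeMonoid.lift_eval_of]
  exact h.lcm_unique (hs.complement a b w hw) (hs.complement b a w' hw').symm

include h hι in
/-- Reversing terminates below any common right multiple. -/
theorem IsLcmSelector.exists_revTo (hs : IsLcmSelector ι f) {ν : M → ℕ}
    (hadd : ∀ x y, ν x + ν y ≤ ν (x * y)) (hpos : ∀ x, x ≠ 1 → 1 ≤ ν x) (z : M)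
    (u v : FreeMonoid A) (hu : LeftDvd (FreeMonoid.lift ι u) z)
    (hv : LeftDvd (FreeMonoid.lift ι v) z) :
    ∃ w w', RevTo f u v w w' ∧ LeftDvd (FreeMonoid.lift ι u * FreeMonoid.lift ι w) z := by
  have hlt : ∀ x y, x ≠ 1 → ν y < ν (x * y) := fun x y hx => by
    have := hadd x y
    have := hpos x hx
    omega
  have hdef : ∀ a b, ∃ w, f a b = some w := fun a b =>
    (hs.defined_iff a b).2 ⟨_, h.isRightLcm_compl _ _⟩
  induction hn : ν z using Nat.strong_induction_on generalizing z u v with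
  | _ n ih =>
    subst hn
    induction u using FreeMonoid.casesOn with
    | one => exact ⟨v, 1, .one_left v, by rwa [map_one, one_mul]⟩
    | of_mul a u =>
    induction v using FreeMonoid.casesOn with
    | one => exact ⟨1, _, .one_right _, by rwa [map_one, mul_one]⟩
    | of_mul b v =>
    obtain ⟨w, hw⟩ := hdef a b
    obtain ⟨w', hw'⟩ := hdef b a
    simp only [map_mul, FreeMonoid.lift_eval_of] at hu hv ⊢
    have hl := hs.complement a b w hw
    have hl' := hs.complement b a w' hw'
    have heq := h.lcm_unique hl hl'.symm
    -- Now `z = (a ∨ b) t`. The other three blocks of the diagram lie under `w t`, `w' t` and `t`,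
    -- all of smaller norm.
    obtain ⟨t, rfl⟩ := hl.2.2 z ((leftDvd_mul _ _).trans hu) ((leftDvd_mul _ _).trans hv)
    have ht : ν t < ν (ι a * FreeMonoid.lift ι w * t) :=
      hlt _ _ fun h1 => hι a (h.conical_left h1)
    have h1 : ν (FreeMonoid.lift ι w * t) < ν (ι a * FreeMonoid.lift ι w * t) := by
      rw [mul_assoc]; exact hlt _ _ (hι a)
    have h2 : ν (FreeMonoid.lift ι w' * t) < ν (ι a * FreeMonoid.lift ι w * t) := by
      rw [heq, mul_assoc]; exact hlt _ _ (hι b)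
    obtain ⟨p, q, hpq, hp⟩ := ih _ h1 _ u w (h.leftDvd_of_mul (by rwa [← mul_assoc]))
      (leftDvd_mul _ _) rfl
    obtain ⟨r, s, hrs, hr⟩ := ih _ h2 _ w' v (leftDvd_mul _ _)
      (h.leftDvd_of_mul (by rwa [← mul_assoc, ← heq])) rfl
    have hpq' := hpq.map_mul_eq (fun u v => hs.map_rels h u v)
    rw [hpq'] at hp
    obtain ⟨r', q', hrq, hr'⟩ := ih _ ht t q r (h.leftDvd_of_mul hp) (h.leftDvd_of_mul hr) rfl
    refine ⟨p * r', s * q', ((RevTo.of_of hw hw').mul_left hpq).mul_right (hrs.mul_left hrq), ?_⟩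
    rw [map_mul, mul_assoc (ι a), ← mul_assoc _ (FreeMonoid.lift ι p), hpq', ← mul_assoc (ι a),
      ← mul_assoc (ι a), mul_assoc _ (FreeMonoid.lift ι q)]
    exact hr'.mul_left _

theorem IsLcmSelector.isReversingModel (hs : IsLcmSelector ι f) (hι : ∀ a, ι a ≠ 1)
    (hG : IsGaussian M) : IsReversingModel f (FreeMonoid.lift ι) where
  surjective := by
    rw [← MonoidHom.mrange_eq_top, FreeMonoid.mrange_lift]
    exact hs.generates
  left_cancel := hG.isLcmMonoid.left_cancel
  eq_one := eq_one_of_lift_eq_one hG.isLcmMonoid hι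
  under_lcm u v := by
    obtain ⟨ν, hadd, hpos⟩ := hG.atomic.exists_norm
    have h := hG.isLcmMonoid
    have key := hs.exists_revTo h hι hadd hpos
    have hl := h.isRightLcm_compl (FreeMonoid.lift ι u) (FreeMonoid.lift ι v)
    obtain ⟨w, w', hw, -⟩ := key _ u v hl.1 hl.2.1
    refine ⟨w, under_eq_some.2 ⟨w', hw⟩, leftDvd_mul _ _, ?_, fun t htu htv => ?_⟩
    · rw [hw.map_mul_eq fun u v => hs.map_rels h u v]
      exact leftDvd_mul _ _
    · obtain ⟨z, z', hz, hd⟩ := key t u v htu htv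
      rwa [(hw.unique hz).1]

theorem IsLcmSelector.isReversingFunction (hs : IsLcmSelector ι f) (hι : ∀ a, ι a ≠ 1)
    (h : IsLcmMonoid M) : IsReversingFunction f where
  self a := by
    obtain ⟨w, hw⟩ := (hs.defined_iff a a).2 ⟨_, h.isRightLcm_compl _ _⟩
    have h1 := h.eq_compl (hs.complement a a w hw)
    rw [h.isComplementOp.self] at h1
    rw [hw, eq_one_of_lift_eq_one h hι h1]
  symm a b _ := (hs.defined_iff b a).2 ⟨_, h.isRightLcm_compl _ _⟩

/-- Each letter has norm at least `1`, so the norm of the value bounds the length of the word. -/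
theorem finite_preimage_lift [Finite A] {ν : M → ℕ} (hadd : ∀ x y, ν x + ν y ≤ ν (x * y))
    (hpos : ∀ x, x ≠ 1 → 1 ≤ ν x) (hι : ∀ a, ι a ≠ 1) {T : Set M} (hT : T.Finite) :
    {w : FreeMonoid A | FreeMonoid.lift ι w ∈ T}.Finite := by
  have hlen : ∀ w : FreeMonoid A, w.toList.length ≤ ν (FreeMonoid.lift ι w) := by
    intro w
    induction w using FreeMonoid.inductionOn' with
    | one => simp
    | of_mul a w ih =>
      have h1 := hadd (ι a) (FreeMonoid.lift ι w)
      have h2 := hpos _ (hι a)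
      rw [FreeMonoid.toList_mul, map_mul, FreeMonoid.lift_eval_of, FreeMonoid.toList_of,
        List.length_append, List.length_singleton]
      omega
  obtain ⟨N, hN⟩ := (hT.image ν).bddAbove
  refine Set.Finite.subset ((List.finite_length_le A N).preimage
    FreeMonoid.toList.injective.injOn) fun w hw => ?_
  exact (hlen w).trans (hN ⟨_, hw, rfl⟩)

/-- If `x (x \ y) z = Δ`, then `(x \ y) z` divides `Δ` on the right, hence on the left. -/
theorem IsGarsideElement.compl_leftDvd {Δ : M} (hΔ : IsGarsideElement Δ) {x y : M}
    (hx : LeftDvd x Δ) (hy : LeftDvd y Δ) : LeftDvd (h.compl x y) Δ := by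
  obtain ⟨z, hz⟩ := (h.isRightLcm_compl x y).2.2 Δ hx hy
  have h1 : h.compl x y * z ∈ {t | LeftDvd t Δ} := by
    rw [hΔ.divisors_eq]
    exact ⟨x, by rw [← mul_assoc, hz]⟩
  exact (leftDvd_mul _ _).trans h1

theorem finite_underClosure_of_isGarside [Finite A] (hG : IsGarside M) (hs : IsLcmSelector ι f)
    (hι : ∀ a, ι a ≠ 1) : (underClosure f).Finite := by
  have hm := hs.isReversingModel hι hG.gaussian
  have h := hm.isLcmMonoid
  obtain ⟨Δ, hΔ⟩ := hG.exists_garside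
  obtain ⟨ν, hadd, hpos⟩ := hG.gaussian.atomic.exists_norm
  have h1 : (1 : M) ∈ {x : M | LeftDvd x Δ} := ⟨Δ, one_mul Δ⟩
  -- Letters need not divide `Δ`; a common power `N` of the divisor set contains them all.
  choose n hn using fun a => exists_mem_pow_of_closure_eq_top hΔ.generate (ι a)
  obtain ⟨N, hN⟩ := (Set.finite_range n).bddAbove
  refine (finite_preimage_lift hadd hpos hι (finite_pow hΔ.finite N)).subset fun w hw => ?_
  change FreeMonoid.lift ι w ∈ {x : M | LeftDvd x Δ} ^ N
  induction hw with
  | base u hu =>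
    obtain ⟨a, rfl⟩ := hu
    rw [FreeMonoid.lift_eval_of]
    exact Set.pow_subset_pow_right h1 (hN ⟨a, rfl⟩) (hn a)
  | step u v w _ _ hw _ ihv =>
    rw [under_eq_wordCompl hm.total, Option.some.injEq] at hw
    rw [← hw, hm.map_wordCompl]
    exact h.isComplementOp.mem_pow_of_mem_pow (X := {x : M | LeftDvd x Δ})
      (fun x hx y hy => hΔ.compl_leftDvd h hx hy) hΔ.generate _ ihv

end

namespace IsReversingModel

variable {π : FreeMonoid A →* M} (hm : IsReversingModel f π)
include hm

theorem cubeOn (X : Set (FreeMonoid A)) : CubeOn f X := by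
  intro u _ v _ w _
  simp only [under_eq_wordCompl hm.total, underBot, Option.bind_some]
  rw [hm.equivPP_iff]
  simp only [hm.map_wordCompl]
  rw [← hm.isLcmMonoid.isComplementOp.mul_left, ← hm.isLcmMonoid.isComplementOp.mul_left,
    hm.isLcmMonoid.mul_compl_comm]

theorem exists_upper_bound [Nonempty A] {T : Set (FreeMonoid A)} (hT : T.Finite)
    (hTJ : T ⊆ joinClosure f) : ∃ Ω ∈ joinClosure f, ∀ u ∈ T, LeftDvd (π u) (π Ω) := by
  induction T, hT using Set.Finite.induction_on with
  | empty =>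
    obtain ⟨a⟩ := ‹Nonempty A›
    exact ⟨FreeMonoid.of a, .base _ (.base _ ⟨a, rfl⟩), by simp⟩
  | @insert u T _ _ ih =>
    obtain ⟨Ω, hΩ, h⟩ := ih ((Set.subset_insert _ _).trans hTJ)
    have hl := hm.isRightLcm_wordCompl u Ω
    refine ⟨_, hm.mul_wordCompl_mem_joinClosure (hTJ (Set.mem_insert _ _)) hΩ, ?_⟩
    intro v hv
    rcases Set.mem_insert_iff.1 hv with rfl | hv
    · exact hl.1
    · exact (h v hv).trans hl.2.1

theorem omegaCondition [Nonempty A] (hfin : (joinClosure f).Finite)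
    (hcan : ∀ {x y z : M}, x * z = y * z → x = y) : OmegaCondition f := by
  obtain ⟨Ω, hΩ, h⟩ := hm.exists_upper_bound hfin subset_rfl
  refine ⟨Ω, hΩ, fun u hu => ⟨hm.under_eq_one_iff.2 (h u hu), ?_⟩⟩
  have hmaps : Set.MapsTo (fun s => hm.isLcmMonoid.compl s (π Ω)) (π '' joinClosure f)
      (π '' joinClosure f) := fun s _ => hm.compl_mem_joinValues s ⟨Ω, hΩ, rfl⟩
  -- `s (s \ Ω) = Ω`, so right cancellation recovers `s` from its complement.
  have hinj : Set.InjOn (fun s => hm.isLcmMonoid.compl s (π Ω)) (π '' joinClosure f) := by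
    rintro _ ⟨s, hs, rfl⟩ _ ⟨t, ht, rfl⟩
      (hst : hm.isLcmMonoid.compl (π s) (π Ω) = hm.isLcmMonoid.compl (π t) (π Ω))
    have h1 := hm.isLcmMonoid.mul_compl_of_leftDvd (h s hs)
    have h2 := hm.isLcmMonoid.mul_compl_of_leftDvd (h t ht)
    rw [hst] at h1
    exact hcan (h1.trans h2.symm)
  obtain ⟨_, ⟨v, hv, rfl⟩, hvu⟩ :=
    ((hfin.image π).injOn_iff_bijOn_of_mapsTo hmaps |>.1 hinj).surjOn ⟨u, hu, rfl⟩
  refine ⟨v, hv, ?_⟩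
  rw [under_eq_wordCompl hm.total, hm.equivPP_iff, hm.map_wordCompl]
  exact hvu

theorem mk_eq_mk {u v : FreeMonoid A} (h : π u = π v) :
    PresentedMonoid.mk (rels f) u = PresentedMonoid.mk (rels f) v := by
  obtain ⟨h1, h2⟩ := hm.equivPP_iff.2 h
  rw [under_eq_wordCompl hm.total, Option.some.injEq] at h1 h2
  exact mk_eq_mk_of_complEquiv hm.total ⟨h1, h2⟩

end IsReversingModel

theorem IsLcmSelector.exists_mulEquiv {ι : A → M} (hs : IsLcmSelector ι f) (hι : ∀ a, ι a ≠ 1)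
    (hG : IsGaussian M) :
    ∃ e : PresentedMonoid (rels f) ≃* M, ∀ a, e (PresentedMonoid.of (rels f) a) = ι a := by
  have hm := hs.isReversingModel hι hG
  let φ : PresentedMonoid (rels f) →* M :=
    PresentedMonoid.lift ι (fun u v huv => hs.map_rels hG.isLcmMonoid u v huv)
  have hφ : ∀ w, φ (PresentedMonoid.mk (rels f) w) = FreeMonoid.lift ι w := fun w => rfl
  refine ⟨MulEquiv.ofBijective φ ⟨fun x y hxy => ?_, fun y => ?_⟩, fun a => ?_⟩
  · induction x, y using PresentedMonoid.inductionOn₂ with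
    | _ u v => exact hm.mk_eq_mk hxy
  · obtain ⟨w, rfl⟩ := hm.surjective y
    exact ⟨_, hφ w⟩
  · exact (hφ _).trans (FreeMonoid.lift_eval_of ι a)

theorem IsLcmSelector.starStar [Nonempty A] [Finite A] {ι : A → M} (hs : IsLcmSelector ι f)
    (hι : ∀ a, ι a ≠ 1) (hG : IsGarside M) : StarStar f := by
  have hm := hs.isReversingModel hι hG.gaussian
  have hfin := finite_underClosure_of_isGarside hG hs hι
  have hf := hs.isReversingFunction hι hG.gaussian.isLcmMonoid
  exact ⟨⟨fun u _ v _ => ⟨_, under_eq_wordCompl hm.total u v⟩, hfin⟩, hm.cubeOn _,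
    hm.omegaCondition (hm.finite_joinClosure hf hfin)
      fun hxy => hG.gaussian.cancel.mul_right_cancel _ hxy⟩

end Selector

/-! ### The presented monoid as a model -/

section Presented

variable {A : Type u} {f : A → A → Option (FreeMonoid A)}

/-- If reversing terminates on the closure of the alphabet, it always terminates. -/
theorem exists_revTo_of_definedOn (hd : DefinedOn (under f) (underClosure f))
    (u v : FreeMonoid A) : ∃ w w', RevTo f u v w w' := by
  -- One argument in the closure suffices: the result is again in the closure, ready for the next
  -- factor of `u`.
  have key : ∀ u : FreeMonoid A, ∀ x ∈ underClosure f, ∃ w ∈ underClosure f, ∃ w',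
      RevTo f u x w w' := by
    intro u x hx
    have hu : u ∈ Submonoid.closure (underClosure f) := closure_underClosure (f := f) ▸ trivial
    induction hu using Submonoid.closure_induction_right with
    | one => exact ⟨x, hx, 1, .one_left x⟩
    | mul_right u _ y hy ih =>
      obtain ⟨w, hw, w', h⟩ := ih
      obtain ⟨z, hz⟩ := hd y hy w hw
      obtain ⟨z', hz'⟩ := under_eq_some.1 hz
      exact ⟨z, OpClosure.step _ _ _ hy hw hz, _, h.mul_left hz'⟩
  have hv : v ∈ Submonoid.closure (underClosure f) := closure_underClosure (f := f) ▸ trivial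
  induction hv using Submonoid.closure_induction_right with
  | one => exact ⟨1, u, .one_right u⟩
  | mul_right v _ x hx ih =>
    obtain ⟨w, w', h⟩ := ih
    obtain ⟨z, -, z', hz⟩ := key w' x hx
    exact ⟨_, _, h.mul_right hz⟩

section

variable (htot : ∀ u v, ∃ w w', RevTo f u v w w')
include htot

/-- The congruence on words defined by reversing, when the cube property holds. -/
def complCon (hf : IsReversingFunction f) (hcube : ∀ u v w, CubeAt (wordCompl f) u v w) :
    Con (FreeMonoid A) where
  r := ComplEquiv (wordCompl f)
  iseqv :=
    have hc := isComplementOp_wordCompl htot hf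
    ⟨hc.equiv_refl, fun h => h.symm, fun h h' => hc.equiv_trans (hcube _ _ _) (hcube _ _ _) h h'⟩
  mul' h h' := (isComplementOp_wordCompl htot hf).equiv_mul h h'

/-- The defining relations are the pairs `a (a \ b)`, `b (b \ a)`, and these are equivalent for any
complement operation. -/
theorem complEquiv_of_mk_eq_mk (hf : IsReversingFunction f)
    (hcube : ∀ u v w, CubeAt (wordCompl f) u v w) {u v : FreeMonoid A}
    (h : PresentedMonoid.mk (rels f) u = PresentedMonoid.mk (rels f) v) :
    ComplEquiv (wordCompl f) u v := by
  have hle : conGen (rels f) ≤ complCon htot hf hcube := by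
    refine Con.conGen_le.2 ?_
    rintro _ _ ⟨a, b, w, w', hw, hw', rfl, rfl⟩
    have h1 := RevTo.of_of hw hw'
    have h2 := (isComplementOp_wordCompl htot hf).mul_equiv_mul (FreeMonoid.of a) (FreeMonoid.of b)
    rwa [wordCompl_eq h1, wordCompl_eq h1.symm] at h2
  exact hle ((Con.eq _).1 h)

/-- When the cube property holds, reversing computes right lcm's in the presented monoid. -/
theorem isReversingModel_mk (hf : IsReversingFunction f)
    (hcube : ∀ u v w, CubeAt (wordCompl f) u v w) :
    IsReversingModel f (PresentedMonoid.mk (rels f)) := by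
  have hc := isComplementOp_wordCompl htot hf
  have heq := fun {u v} => complEquiv_of_mk_eq_mk htot hf hcube (u := u) (v := v)
  have hdvd : ∀ u t, LeftDvd (PresentedMonoid.mk (rels f) u) (PresentedMonoid.mk (rels f) t) →
      wordCompl f t u = 1 := by
    rintro u t ⟨x, hx⟩
    obtain ⟨x, rfl⟩ := PresentedMonoid.surjective_mk x
    rw [← map_mul] at hx
    -- Replacing `t` by `u x` is harmless: `(u x) \ u = x \ (u \ u)` is empty, and only the empty
    -- word is equivalent to it.
    have h1 := hc.equiv_left (hcube _ _ u) (heq hx)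
    rw [hc.mul_left, hc.self, hc.one_right] at h1
    exact hc.equiv_one h1
  refine ⟨PresentedMonoid.surjective_mk, ?_, ?_, fun u v => ?_⟩
  · intro x y z h
    obtain ⟨x, rfl⟩ := PresentedMonoid.surjective_mk x
    obtain ⟨y, rfl⟩ := PresentedMonoid.surjective_mk y
    obtain ⟨z, rfl⟩ := PresentedMonoid.surjective_mk z
    rw [← map_mul, ← map_mul] at h
    have h1 := heq h
    rw [ComplEquiv, hc.mul_left_mul, hc.mul_left_mul] at h1
    exact mk_eq_mk_of_complEquiv htot h1
  · intro w h
    rw [← map_one (PresentedMonoid.mk (rels f))] at h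
    exact hc.equiv_one (heq h).symm
  · refine ⟨_, under_eq_wordCompl htot u v, leftDvd_mul _ _, ?_, fun t hu hv => ?_⟩
    · rw [(revTo_wordCompl htot u v).map_mul_eq mk_rels]
      exact leftDvd_mul _ _
    · obtain ⟨t, rfl⟩ := PresentedMonoid.surjective_mk t
      have hu' := hdvd u t hu
      have h1 : wordCompl f t (u * wordCompl f u v) = 1 := by
        rw [hc.mul_right, hu', one_mul]
        exact hc.eq_one_of_cubeAt (hcube t u v) hu' (hdvd v t hv)
      have h2 := (revTo_wordCompl htot t (u * wordCompl f u v)).map_mul_eq mk_rels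
      rw [h1, map_one, mul_one, map_mul] at h2
      rw [h2]
      exact leftDvd_mul _ _

end

theorem isReversingModel_mk_of_cubeOn (hf : IsReversingFunction f)
    (hd : DefinedOn (under f) (underClosure f)) (hcube : CubeOn f (underClosure f)) :
    IsReversingModel f (PresentedMonoid.mk (rels f)) := by
  have htot := exists_revTo_of_definedOn hd
  refine isReversingModel_mk htot hf ((isComplementOp_wordCompl htot hf).cubeAt_of_closure
    (fun _ hu _ hv => wordCompl_mem_underClosure htot hu hv) closure_underClosure ?_)
  intro u hu v hv w hw
  have h := hcube u hu v hv w hw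
  simp only [under_eq_wordCompl htot, underBot, Option.bind_some, EquivPP,
    Option.some.injEq] at h
  exact h

theorem IsReversingModel.isLcmSelector_of (hm : IsReversingModel f (PresentedMonoid.mk (rels f))) :
    IsLcmSelector (PresentedMonoid.of (rels f)) f where
  generates := PresentedMonoid.closure_range_of _
  defined_iff a b := by
    obtain ⟨w, w', h⟩ := hm.total (FreeMonoid.of a) (FreeMonoid.of b)
    exact iff_of_true ⟨w, h.eq_some_of_of.1⟩ ⟨_, hm.isLcmMonoid.isRightLcm_compl _ _⟩
  complement a b w hw := by
    have hlift : FreeMonoid.lift (PresentedMonoid.of (rels f)) = PresentedMonoid.mk (rels f) :=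
      FreeMonoid.hom_eq fun _ => rfl
    obtain ⟨z, z', h⟩ := hm.total (FreeMonoid.of a) (FreeMonoid.of b)
    have hz := h.eq_some_of_of.1
    rw [hw, Option.some.injEq] at hz
    have h1 := hm.isRightLcm_wordCompl (FreeMonoid.of a) (FreeMonoid.of b)
    rw [wordCompl_eq h, ← hz, map_mul] at h1
    rw [hlift]
    exact h1

end Presented

end GarsideReversing

open GarsideReversing

theorem mainTheorem2 {A : Type u} [Nonempty A] (f : A → A → Option (FreeMonoid A)) :
    (∀ (M : Type v) [Monoid M] (ι : A → M), Finite A → (∀ a, ι a ≠ 1) →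
      IsGarside M → IsLcmSelector ι f →
        IsReversingFunction f ∧ StarStar f ∧
          ∃ e : PresentedMonoid (rels f) ≃* M, ∀ a, e (PresentedMonoid.of (rels f) a) = ι a) ∧
    (IsReversingFunction f → StarStar f →
      IsGarside (PresentedMonoid (rels f)) ∧
        IsLcmSelector (PresentedMonoid.of (rels f)) f) ∧
    (IsReversingFunction f → FiniteClosure f → CubeOn f (underClosure f) →
      DefinedOn (join f) (joinClosure f) ∧ (joinClosure f).Finite) := by
  refine ⟨fun M _ ι _ hι hG hs => ?_, fun hf hss => ?_, fun hf hfc hcube => ?_⟩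
  · exact ⟨hs.isReversingFunction hι hG.gaussian.isLcmMonoid, hs.starStar hι hG,
      hs.exists_mulEquiv hι hG.gaussian⟩
  · have hm := isReversingModel_mk_of_cubeOn hf hss.finite_closure.1 hss.cube
    exact ⟨hm.isGarside hss.finite_closure.2 hss.omega, hm.isLcmSelector_of⟩
  · have hm := isReversingModel_mk_of_cubeOn hf hfc.1 hcube
    exact ⟨hm.definedOn_join _, hm.finite_joinClosure hf hfc.2⟩
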